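/- Let $d\ge 3$, and for $n\ge 1$ let $c_n\in\mathbb R^d$ and $r_n>0$ be such that the closed balls $\overline B(c_n,r_n)$, $n\ge1$, are non-overlapping (distinct balls have disjoint interiors) and none of them contains the origin. Assume that (S) there is $\epsilon>0$ such that $|c_n-c_m|\ge 2\epsilon$ for all $n\ne m$, and that there is a number $M$ such that $r_n^{d-2}|c_n|^2\le M$ for all $n\ge 1$. If the collection of balls is avoidable, that is, if standard Brownian motion in $\mathbb R^d$ started at $0$ has positive probability of never hitting any of the balls $\overline B(c_n,r_n)$, then \[ \sum_{n=1}^\infty\left(\frac{r_n}{|c_n|}\right)^{d-2}<\infty . \] -/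

import Mathlib

open MeasureTheory ProbabilityTheory
open scoped NNReal

namespace AvoidableBalls

/-- A standard Brownian motion in `ℝ^d` started at the origin: the `d` coordinate processes are
(jointly) independent standard real Brownian motions. Each coordinate starts at `0` almost surely,
has the Brownian finite-dimensional laws and almost surely continuous paths. -/
structure IsBrownianMotion {Ω : Type*} [MeasurableSpace Ω] {d : ℕ}
    (B : ℝ≥0 → Ω → EuclideanSpace ℝ (Fin d)) (P : Measure Ω) : Prop where
  coord : ∀ i : Fin d, IsBrownianReal (fun t ω => B t ω i) P
  indep : iIndepFun (fun (i : Fin d) (ω : Ω) (t : ℝ≥0) => B t ω i) P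

/-- The event that the process `B` never hits any of the closed balls with centres `c n` and
radii `r n`. -/
def avoidEvent {Ω : Type*} {d : ℕ} (B : ℝ≥0 → Ω → EuclideanSpace ℝ (Fin d))
    (c : ℕ → EuclideanSpace ℝ (Fin d)) (r : ℕ → ℝ) : Set Ω :=
  {ω | ∀ t : ℝ≥0, ∀ n : ℕ, B t ω ∉ Metric.closedBall (c n) (r n)}

/-- The collection of closed balls with centres `c n` and radii `r n` is avoidable (for the
Brownian motion `B` from the origin, under `P`): with positive probability, `B` never hits any of
the balls. This depends only on the law of `B`, so not on the choice of Brownian motion. -/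
def Avoidable {Ω : Type*} [MeasurableSpace Ω] {d : ℕ}
    (B : ℝ≥0 → Ω → EuclideanSpace ℝ (Fin d)) (P : Measure Ω)
    (c : ℕ → EuclideanSpace ℝ (Fin d)) (r : ℕ → ℝ) : Prop :=
  0 < P (avoidEvent B c r)

/-- The closed balls with centres `c n` and radii `r n` are non-overlapping: distinct ones have
disjoint interiors. -/
def NonOverlapping {d : ℕ} (c : ℕ → EuclideanSpace ℝ (Fin d)) (r : ℕ → ℝ) : Prop :=
  Pairwise fun n m => Disjoint (Metric.ball (c n) (r n)) (Metric.ball (c m) (r m))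

/-- The separation condition on the centres. -/
def Separated {d : ℕ} (c : ℕ → EuclideanSpace ℝ (Fin d)) : Prop :=
  ∃ ε : ℝ, 0 < ε ∧ ∀ n m : ℕ, n ≠ m → 2 * ε ≤ ‖c n - c m‖

end AvoidableBalls

/-! Argue by contradiction with the second moment method. If the sum diverges, then for every
starting point `y` there is a finite family of small, far away balls with `S = ∑ (r n / ‖c n - y‖) ^
(d - 2) ≥ 1`. Let `Z` be the occupation time of these balls by Brownian motion sampled at multiples
of a small step `h`, a visit to ball `n` being weighted by `(r n)⁻²`. Green function estimates show
that `E Z` is at least a multiple of `S`. If also, from each point of the balls, the expected later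
occupation is at most `Q * S`, then `E Z² ≤ (1 + 2 Q S) E Z`, and the balls are hit with probability
at least a multiple of `S / (1 + 2 Q S) ≥ 1 / (1 + 2 Q)`, uniformly in `y` (`le_prob_hit_support`,
`exists_uniform_hit_prob`).

The bound `Q * S` is where separation and the size condition enter: `exists_interaction_bound`
controls the potential of the other balls at a centre by a constant plus a multiple of `S`, and `S ≥
1` absorbs the constant.

With a hitting probability at least `δ > 0` from every point, the Markov property at time `T` gives
`P(avoid forever) ≤ (1 - δ) P(avoid up to T)`. Letting `T → ∞` yields `p ≤ (1 - δ) p`, so `p = 0`.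
Avoiding the closed balls at all times implies avoiding the open ones at rational times, so a
countable skeleton of the path suffices throughout. -/

namespace AvoidableBalls

/-! ### Packing estimates and interaction between balls -/

section Packing

theorem volume_real_ball {d : ℕ} (x : EuclideanSpace ℝ (Fin d)) {s : ℝ} (hs : 0 < s) :
    volume.real (Metric.ball x s)
      = s ^ d * volume.real (Metric.ball (0 : EuclideanSpace ℝ (Fin d)) 1) := by
  rw [measureReal_def, Measure.addHaar_ball_of_pos _ _ hs, ENNReal.toReal_mul,
    ENNReal.toReal_ofReal (by positivity), finrank_euclideanSpace_fin, measureReal_def]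

theorem volume_real_unitBall_pos (d : ℕ) :
    0 < volume.real (Metric.ball (0 : EuclideanSpace ℝ (Fin d)) 1) :=
  ENNReal.toReal_pos (Metric.measure_ball_pos _ _ one_pos).ne' measure_ball_lt_top.ne

variable {ι : Type*} {d : ℕ}

/-- A `2ε`-separated finite family in a ball of radius `ρ` has at most `((ρ + ε) / ε) ^ d` points. -/
theorem card_le_of_separated {ε ρ : ℝ} (hε : 0 < ε) (hρ : 0 ≤ ρ) (F : Finset ι)
    (z : ι → EuclideanSpace ℝ (Fin d))
    (hsep : ∀ n ∈ F, ∀ m ∈ F, n ≠ m → 2 * ε ≤ ‖z n - z m‖) (hz : ∀ n ∈ F, ‖z n‖ ≤ ρ) :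
    (F.card : ℝ) ≤ ((ρ + ε) / ε) ^ d := by
  have hdisj : (F : Set ι).PairwiseDisjoint fun n => Metric.ball (z n) ε := by
    intro n hn m hm hnm
    refine Metric.ball_disjoint_ball ?_
    rw [dist_eq_norm]
    linarith [hsep n hn m hm hnm]
  have hsub : (⋃ n ∈ F, Metric.ball (z n) ε) ⊆ Metric.ball 0 (ρ + ε) := by
    refine Set.iUnion₂_subset fun n hn => Metric.ball_subset_ball' ?_
    rw [dist_zero_right]
    linarith [hz n hn]
  have h1 := measureReal_mono (μ := volume) hsub measure_ball_lt_top.ne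
  rw [measureReal_biUnion_finset hdisj fun n _ => measurableSet_ball] at h1
  have hV := volume_real_unitBall_pos d
  simp only [volume_real_ball _ hε, volume_real_ball _ (show 0 < ρ + ε by positivity), Finset.sum_const, nsmul_eq_mul] at h1
  rw [div_pow, le_div_iff₀ (by positivity)]
  rw [← mul_assoc] at h1
  exact le_of_mul_le_mul_right h1 hV

/-- By packing, the annulus `ε 2^i ≤ ‖z‖ < ε 2^(i+1)` holds at most `(4 * 2^i) ^ d` points, so with
exponent `d - 1` it contributes a constant times `2^i`. These contributions sum geometrically. -/
theorem sum_inv_norm_pow_dyadic {ε : ℝ} (hε : 0 < ε) (hd : 1 ≤ d)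
    (z : ι → EuclideanSpace ℝ (Fin d)) (j : ℕ) (F : Finset ι)
    (hsep : ∀ n ∈ F, ∀ m ∈ F, n ≠ m → 2 * ε ≤ ‖z n - z m‖)
    (hlow : ∀ n ∈ F, ε ≤ ‖z n‖) (hz : ∀ n ∈ F, ‖z n‖ < ε * 2 ^ j) :
    ∑ n ∈ F, (‖z n‖ ^ (d - 1))⁻¹ ≤ 4 ^ d * (ε ^ (d - 1))⁻¹ * 2 ^ j := by
  classical
  induction j generalizing F with
  | zero =>
    have : F = ∅ := by
      refine Finset.eq_empty_of_forall_notMem fun n hn => ?_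
      have := hlow n hn
      have := hz n hn
      simp at this
      linarith
    subst this
    simp only [Finset.sum_empty]
    positivity
  | succ j ih =>
    rw [← Finset.sum_filter_add_sum_filter_not F fun n => ‖z n‖ < ε * 2 ^ j]
    have h1 := ih (F.filter fun n => ‖z n‖ < ε * 2 ^ j)
      (fun n hn m hm => hsep n (Finset.mem_filter.1 hn).1 m (Finset.mem_filter.1 hm).1)
      (fun n hn => hlow n (Finset.mem_filter.1 hn).1) (fun n hn => (Finset.mem_filter.1 hn).2)
    set G := F.filter fun n => ¬ ‖z n‖ < ε * 2 ^ j
    have hcard : (G.card : ℝ) ≤ (4 * 2 ^ j) ^ d := by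
      refine (card_le_of_separated hε (ρ := ε * 2 ^ (j + 1)) (by positivity) G z
        (fun n hn m hm => hsep n (Finset.mem_filter.1 hn).1 m (Finset.mem_filter.1 hm).1)
        fun n hn => (hz n (Finset.mem_filter.1 hn).1).le).trans ?_
      refine pow_le_pow_left₀ (by positivity) ?_ _
      rw [div_le_iff₀ hε]
      have : (1 : ℝ) ≤ 2 ^ j := one_le_pow₀ (by norm_num)
      rw [pow_succ]
      nlinarith
    have h2 : ∑ n ∈ G, (‖z n‖ ^ (d - 1))⁻¹ ≤ 4 ^ d * (ε ^ (d - 1))⁻¹ * 2 ^ j := by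
      calc ∑ n ∈ G, (‖z n‖ ^ (d - 1))⁻¹ ≤ ∑ n ∈ G, ((ε * 2 ^ j) ^ (d - 1))⁻¹ := by
            refine Finset.sum_le_sum fun n hn => ?_
            have := not_lt.1 (Finset.mem_filter.1 hn).2
            gcongr
        _ = G.card * ((ε * 2 ^ j) ^ (d - 1))⁻¹ := by simp
        _ ≤ (4 * 2 ^ j) ^ d * ((ε * 2 ^ j) ^ (d - 1))⁻¹ := by gcongr
        _ = 4 ^ d * (ε ^ (d - 1))⁻¹ * 2 ^ j := by
            obtain ⟨e, rfl⟩ : ∃ e, d = e + 1 := ⟨d - 1, by omega⟩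
            simp only [Nat.add_sub_cancel]
            rw [mul_pow, mul_pow, pow_succ ((2 : ℝ) ^ j)]
            field_simp
    calc _ ≤ _ := add_le_add h1 h2
      _ = _ := by ring

/-- Lattice-type sums: for a separated family away from the origin inside a ball of radius `R`, the
sum of `‖z‖ ^ (-a)` is comparable with `R ^ (d - a)` when `a < d`. -/
theorem sum_inv_norm_pow_le {ε R : ℝ} (hε : 0 < ε) (a b : ℕ) (hd : a + b + 1 = d)
    (z : ι → EuclideanSpace ℝ (Fin d)) (F : Finset ι)
    (hsep : ∀ n ∈ F, ∀ m ∈ F, n ≠ m → 2 * ε ≤ ‖z n - z m‖)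
    (hlow : ∀ n ∈ F, ε ≤ ‖z n‖) (hz : ∀ n ∈ F, ‖z n‖ ≤ R) (hR : 0 ≤ R) :
    ∑ n ∈ F, (‖z n‖ ^ a)⁻¹ ≤ 4 ^ d * (ε ^ (d - 1))⁻¹ * (2 / ε) * R ^ (b + 1) := by
  rcases F.eq_empty_or_nonempty with rfl | ⟨n₀, hn₀⟩
  · simp only [Finset.sum_empty]; positivity
  have hRε : ε ≤ R := (hlow n₀ hn₀).trans (hz n₀ hn₀)
  obtain ⟨j, hj1, hj2⟩ := exists_nat_pow_near (x := R / ε) (y := (2 : ℝ))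
    ((one_le_div hε).2 hRε) (by norm_num)
  have h1 := sum_inv_norm_pow_dyadic hε (by omega) z (j + 1) F hsep hlow fun n hn => by
    rw [div_lt_iff₀ hε] at hj2
    linarith [hz n hn]
  -- Since `a + b = d - 1` and `‖z n‖ ≤ R`, every exponent `a` reduces to `d - 1` at the cost of `R
  -- ^ b`.
  calc ∑ n ∈ F, (‖z n‖ ^ a)⁻¹ ≤ ∑ n ∈ F, R ^ b * (‖z n‖ ^ (d - 1))⁻¹ := by
        refine Finset.sum_le_sum fun n hn => ?_
        have hp : 0 < ‖z n‖ := hε.trans_le (hlow n hn)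
        have : d - 1 = a + b := by omega
        rw [this, pow_add, mul_inv, mul_comm, mul_assoc]
        refine le_mul_of_one_le_right (by positivity) ?_
        rw [inv_mul_eq_div, one_le_div (by positivity)]
        exact pow_le_pow_left₀ hp.le (hz n hn) _
    _ = R ^ b * ∑ n ∈ F, (‖z n‖ ^ (d - 1))⁻¹ := by rw [Finset.mul_sum]
    _ ≤ R ^ b * (4 ^ d * (ε ^ (d - 1))⁻¹ * 2 ^ (j + 1)) := by gcongr
    _ ≤ R ^ b * (4 ^ d * (ε ^ (d - 1))⁻¹ * (2 * (R / ε))) := by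
        gcongr
        rw [pow_succ]; linarith
    _ = _ := by rw [pow_succ]; ring

/-- Under the size condition `r ^ (d - 2) * ‖c‖ ^ 2 ≤ M`, the total Newtonian potential of the other
balls at the centre `c m` is bounded in terms of their potential at the origin. -/
theorem exists_interaction_bound [DecidableEq ι] (hd : 3 ≤ d) {ε M : ℝ} (hε : 0 < ε) (hM0 : 0 ≤ M) :
    ∃ C : ℝ, 0 ≤ C ∧ ∀ (F : Finset ι) (c : ι → EuclideanSpace ℝ (Fin d)) (r : ι → ℝ),
      (∀ n ∈ F, 0 < r n) → (∀ n ∈ F, ε ≤ ‖c n‖) →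
      (∀ n ∈ F, ∀ m ∈ F, n ≠ m → 2 * ε ≤ ‖c n - c m‖) →
      (∀ n ∈ F, r n ^ (d - 2) * ‖c n‖ ^ 2 ≤ M) → ∀ m ∈ F,
      ∑ n ∈ F with n ≠ m, (r n / ‖c n - c m‖) ^ (d - 2)
        ≤ C + 2 ^ (d - 2) * ∑ n ∈ F, (r n / ‖c n‖) ^ (d - 2) := by
  set L : ℝ := 4 ^ d * (ε ^ (d - 1))⁻¹ * (2 / ε) with hL
  have hL0 : 0 ≤ L := by positivity
  refine ⟨36 * M * L + 2 ^ (d - 2) * M * L, by positivity, ?_⟩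
  intro F c r hr hlow hsep hM m hm
  set R := ‖c m‖
  have hR : 0 < R := hε.trans_le (hlow m hm)
  set F' := F.filter fun n => n ≠ m
  have hF' : ∀ n ∈ F', n ∈ F ∧ n ≠ m := fun n hn => Finset.mem_filter.1 hn
  set F2 := F'.filter fun n => ‖c n - c m‖ ≤ 3 * R
  set F3 := F'.filter fun n => ‖c n‖ ≤ R
  have hF2 : ∀ n ∈ F2, n ∈ F ∧ n ≠ m ∧ ‖c n - c m‖ ≤ 3 * R := fun n hn =>
    ⟨(hF' n (Finset.mem_filter.1 hn).1).1, (hF' n (Finset.mem_filter.1 hn).1).2,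
      (Finset.mem_filter.1 hn).2⟩
  have hF3 : ∀ n ∈ F3, n ∈ F ∧ ‖c n‖ ≤ R := fun n hn =>
    ⟨(hF' n (Finset.mem_filter.1 hn).1).1, (Finset.mem_filter.1 hn).2⟩
  have s2 : ∑ n ∈ F2, (‖c n - c m‖ ^ (d - 2))⁻¹ ≤ L * (3 * R) ^ 2 := by
    refine sum_inv_norm_pow_le hε (d - 2) 1 (by omega) (fun n => c n - c m) F2 ?_ ?_ ?_ (by positivity)
    · intro n hn k hk hnk
      simpa using hsep n (hF2 n hn).1 k (hF2 k hk).1 hnk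
    · intro n hn
      have := hsep n (hF2 n hn).1 m hm (hF2 n hn).2.1
      linarith
    · exact fun n hn => (hF2 n hn).2.2
  have s3 : ∑ n ∈ F3, (‖c n‖ ^ 2)⁻¹ ≤ L * R ^ (d - 2) := by
    have := sum_inv_norm_pow_le hε 2 (d - 3) (by omega) c F3
      (fun n hn k hk => hsep n (hF3 n hn).1 k (hF3 k hk).1) (fun n hn => hlow n (hF3 n hn).1)
      (fun n hn => (hF3 n hn).2) hR.le
    rwa [show d - 3 + 1 = d - 2 by omega] at this
  have hpt : ∀ n ∈ F', (r n / ‖c n - c m‖) ^ (d - 2) ≤ 2 ^ (d - 2) * (r n / ‖c n‖) ^ (d - 2)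
      + ((if ‖c n - c m‖ ≤ 3 * R then 4 * M / R ^ 2 * (‖c n - c m‖ ^ (d - 2))⁻¹ else 0)
      + if ‖c n‖ ≤ R then (2 / R) ^ (d - 2) * M * (‖c n‖ ^ 2)⁻¹ else 0) := by
    intro n hn
    obtain ⟨hnF, hnm⟩ := hF' n hn
    have hrn := hr n hnF
    have hcn : 0 < ‖c n‖ := hε.trans_le (hlow n hnF)
    have hD : 0 < ‖c n - c m‖ := by linarith [hsep n hnF m hm hnm]
    have hrM : r n ^ (d - 2) ≤ M * (‖c n‖ ^ 2)⁻¹ := by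
      rw [← div_eq_mul_inv, le_div_iff₀ (by positivity)]; exact hM n hnF
    have t1 : 0 ≤ 2 ^ (d - 2) * (r n / ‖c n‖) ^ (d - 2) := by positivity
    have t2 : 0 ≤ (if ‖c n - c m‖ ≤ 3 * R then 4 * M / R ^ 2 * (‖c n - c m‖ ^ (d - 2))⁻¹ else 0) := by
      split_ifs <;> positivity
    have t3 : 0 ≤ (if ‖c n‖ ≤ R then (2 / R) ^ (d - 2) * M * (‖c n‖ ^ 2)⁻¹ else 0) := by
      split_ifs <;> positivity
    have tri1 : ‖c n‖ - R ≤ ‖c n - c m‖ := norm_sub_norm_le _ _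
    have tri2 : R - ‖c n‖ ≤ ‖c n - c m‖ := by rw [norm_sub_rev]; exact norm_sub_norm_le _ _
    have tri3 : ‖c n - c m‖ ≤ ‖c n‖ + R := norm_sub_le _ _
    -- Far centres are at least `‖c n‖ / 2` from `c m`, which compares with the potential at the
    -- origin. Centres at distance between `R / 2` and `2 R` from the origin have `r n ^ (d - 2) ≤ 4
    -- M / R ^ 2` and lie within `3 R` of `c m`. The remaining ones are at least `R / 2` from `c m`.
    -- The last two groups have bounded totals by `s2` and `s3`.
    rcases le_or_gt (2 * R) ‖c n‖ with h | h
    · have : (r n / ‖c n - c m‖) ^ (d - 2) ≤ 2 ^ (d - 2) * (r n / ‖c n‖) ^ (d - 2) := by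
        rw [← mul_pow]
        refine pow_le_pow_left₀ (by positivity) ?_ _
        rw [← mul_div_assoc, div_le_div_iff₀ hD hcn]
        nlinarith
      linarith
    · rcases le_or_gt (R / 2) ‖c n‖ with h' | h'
      · have : (r n / ‖c n - c m‖) ^ (d - 2) ≤
            (if ‖c n - c m‖ ≤ 3 * R then 4 * M / R ^ 2 * (‖c n - c m‖ ^ (d - 2))⁻¹ else 0) := by
          rw [if_pos (by linarith), div_pow, div_eq_mul_inv]
          gcongr
          refine hrM.trans ?_
          rw [← div_eq_mul_inv, div_le_div_iff₀ (by positivity) (by positivity)]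
          have : R ^ 2 ≤ 4 * ‖c n‖ ^ 2 := by nlinarith
          nlinarith
        linarith
      · have : (r n / ‖c n - c m‖) ^ (d - 2) ≤
            (if ‖c n‖ ≤ R then (2 / R) ^ (d - 2) * M * (‖c n‖ ^ 2)⁻¹ else 0) := by
          rw [if_pos (by linarith), div_eq_inv_mul, mul_pow, mul_assoc]
          gcongr
          rw [inv_eq_one_div, div_le_div_iff₀ hD hR]
          linarith
        linarith
  refine (Finset.sum_le_sum hpt).trans ?_
  rw [Finset.sum_add_distrib, Finset.sum_add_distrib, ← Finset.sum_filter, ← Finset.sum_filter,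
    ← Finset.mul_sum, ← Finset.mul_sum, ← Finset.mul_sum]
  have e1 : ∑ n ∈ F', (r n / ‖c n‖) ^ (d - 2) ≤ ∑ n ∈ F, (r n / ‖c n‖) ^ (d - 2) := by
    refine Finset.sum_le_sum_of_subset_of_nonneg (Finset.filter_subset _ _) fun n hn _ => ?_
    have := hr n hn
    positivity
  have e2 : 4 * M / R ^ 2 * ∑ n ∈ F2, (‖c n - c m‖ ^ (d - 2))⁻¹ ≤ 36 * M * L := by
    calc _ ≤ 4 * M / R ^ 2 * (L * (3 * R) ^ 2) := by gcongr
      _ = _ := by field_simp; ring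
  have e3 : (2 / R) ^ (d - 2) * M * ∑ n ∈ F3, (‖c n‖ ^ 2)⁻¹ ≤ 2 ^ (d - 2) * M * L := by
    calc _ ≤ (2 / R) ^ (d - 2) * M * (L * R ^ (d - 2)) := by gcongr
      _ = _ := by rw [div_pow]; field_simp
  have e1' := mul_le_mul_of_nonneg_left e1 (show (0 : ℝ) ≤ 2 ^ (d - 2) by positivity)
  linarith

end Packing

/-! ### Gaussian estimates for the heat kernel -/

section HeatKernel

/-- The law at time `t` of a standard Brownian motion in `ℝ^d` started at the origin. -/
noncomputable def heatLaw (d : ℕ) (t : ℝ≥0) : Measure (EuclideanSpace ℝ (Fin d)) :=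
  (Measure.pi fun _ : Fin d => gaussianReal 0 t).map (WithLp.toLp 2)

/-- The heat kernel, the density of `heatLaw`. -/
noncomputable def heatKernel (d : ℕ) (t : ℝ≥0) (x : EuclideanSpace ℝ (Fin d)) : ℝ :=
  (√(2 * Real.pi * t))⁻¹ ^ d * Real.exp (-‖x‖ ^ 2 / (2 * t))

instance {d : ℕ} {t : ℝ≥0} : IsProbabilityMeasure (heatLaw d t) :=
  Measure.isProbabilityMeasure_map (by fun_prop)

theorem pi_gaussianReal_eq_withDensity (d : ℕ) {t : ℝ≥0} (ht : t ≠ 0) :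
    (Measure.pi fun _ : Fin d => gaussianReal 0 t) =
      (volume : Measure (Fin d → ℝ)).withDensity
        fun x => ENNReal.ofReal (∏ i, gaussianPDFReal 0 t (x i)) := by
  refine (Measure.pi_eq fun s hs => ?_)
  rw [withDensity_apply _ (MeasurableSet.univ_pi hs), volume_pi, Measure.restrict_pi_pi,
    ← ofReal_integral_eq_lintegral_ofReal
      (Integrable.fintype_prod fun i => (integrable_gaussianPDFReal 0 t).restrict)
      (ae_of_all _ fun x => Finset.prod_nonneg fun i _ => gaussianPDFReal_nonneg _ _ _),
    integral_fintype_prod_eq_prod (fun _ => gaussianPDFReal 0 t),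
    ENNReal.ofReal_prod_of_nonneg fun i _ => integral_nonneg fun x => gaussianPDFReal_nonneg _ _ _]
  exact Finset.prod_congr rfl fun i _ => (gaussianReal_apply_eq_integral 0 ht (s i)).symm

theorem prod_gaussianPDFReal_eq_heatKernel (d : ℕ) (t : ℝ≥0) (x : EuclideanSpace ℝ (Fin d)) :
    ∏ i, gaussianPDFReal 0 t (x i) = heatKernel d t x := by
  simp only [gaussianPDFReal, sub_zero, heatKernel]
  rw [Finset.prod_mul_distrib, ← Real.exp_sum, EuclideanSpace.real_norm_sq_eq, ← Finset.sum_div,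
    Finset.sum_neg_distrib]
  simp

theorem heatLaw_eq_withDensity (d : ℕ) {t : ℝ≥0} (ht : t ≠ 0) :
    heatLaw d t = volume.withDensity fun x => ENNReal.ofReal (heatKernel d t x) := by
  have hm : Measurable fun x : EuclideanSpace ℝ (Fin d) => ENNReal.ofReal (heatKernel d t x) := by
    unfold heatKernel; fun_prop
  ext s hs
  rw [heatLaw, Measure.map_apply (by fun_prop) hs, pi_gaussianReal_eq_withDensity d ht,
    withDensity_apply _ (by measurability), withDensity_apply _ hs,
    ← (PiLp.volume_preserving_toLp (Fin d)).setLIntegral_comp_preimage hs hm]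
  simp_rw [← prod_gaussianPDFReal_eq_heatKernel]

theorem heatLaw_le_of_heatKernel_le {d : ℕ} {t : ℝ≥0} (ht : t ≠ 0)
    {s : Set (EuclideanSpace ℝ (Fin d))} (hs : MeasurableSet s) (hv : volume s ≠ ⊤) {A : ℝ}
    (hA0 : 0 ≤ A) (hA : ∀ x ∈ s, heatKernel d t x ≤ A) :
    (heatLaw d t).real s ≤ A * volume.real s := by
  rw [heatLaw_eq_withDensity d ht, measureReal_def, withDensity_apply _ hs]
  have : ∫⁻ x in s, ENNReal.ofReal (heatKernel d t x) ≤ ENNReal.ofReal A * volume s := by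
    rw [← setLIntegral_const]
    exact setLIntegral_mono measurable_const fun x hx => ENNReal.ofReal_le_ofReal (hA x hx)
  refine (ENNReal.toReal_mono (ENNReal.mul_ne_top ENNReal.ofReal_ne_top hv) this).trans ?_
  rw [ENNReal.toReal_mul, ENNReal.toReal_ofReal hA0, measureReal_def]

theorem le_heatLaw_of_le_heatKernel {d : ℕ} {t : ℝ≥0} (ht : t ≠ 0)
    {s : Set (EuclideanSpace ℝ (Fin d))} (hs : MeasurableSet s) {A : ℝ}
    (hA0 : 0 ≤ A) (hA : ∀ x ∈ s, A ≤ heatKernel d t x) :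
    A * volume.real s ≤ (heatLaw d t).real s := by
  have h : ENNReal.ofReal A * volume s ≤ heatLaw d t s := by
    rw [heatLaw_eq_withDensity d ht, withDensity_apply _ hs, ← setLIntegral_const]
    refine setLIntegral_mono ?_ fun x hx => ENNReal.ofReal_le_ofReal (hA x hx)
    unfold heatKernel; fun_prop
  have := ENNReal.toReal_mono (measure_ne_top _ _) h
  rwa [ENNReal.toReal_mul, ENNReal.toReal_ofReal hA0] at this

/-- The inequality `1 + u ≤ exp u` at `u = ‖x‖² / (d t)` trades the Gaussian factor for a power,
giving one bound valid for all `x` and `t`. -/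
theorem heatKernel_le {d : ℕ} (hd : 1 ≤ d) {t : ℝ≥0} (ht : 0 < t) (x : EuclideanSpace ℝ (Fin d)) :
    heatKernel d t x ≤ √d ^ d / √(‖x‖ ^ 2 + t) ^ d := by
  have ht' : (0 : ℝ) < t := ht
  have hd' : (1 : ℝ) ≤ d := by exact_mod_cast hd
  set v := ‖x‖ ^ 2 / (2 * t) with hv
  have hv0 : 0 ≤ v := by positivity
  have key : √(‖x‖ ^ 2 + t) ≤ √d * √t * Real.exp (v / d) := by
    refine Real.sqrt_le_iff.2 ⟨by positivity, ?_⟩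
    rw [mul_pow, mul_pow, Real.sq_sqrt (by positivity), Real.sq_sqrt ht'.le, ← Real.exp_nat_mul]
    have h1 := Real.add_one_le_exp (((2 : ℕ) : ℝ) * (v / d))
    have h2 : ‖x‖ ^ 2 + t ≤ d * t * (((2 : ℕ) : ℝ) * (v / d) + 1) := by
      have : d * t * (((2 : ℕ) : ℝ) * (v / d) + 1) = ‖x‖ ^ 2 + d * t := by
        rw [hv]; field_simp; push_cast; ring
      rw [this]
      nlinarith
    exact h2.trans (by gcongr)
  have hpow := pow_le_pow_left₀ (Real.sqrt_nonneg _) key d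
  rw [mul_pow, ← Real.exp_nat_mul, mul_div_cancel₀ _ (by positivity), mul_pow] at hpow
  rw [le_div_iff₀ (by positivity), heatKernel, neg_div, ← hv, Real.exp_neg]
  have hs : √(t : ℝ) ≤ √(2 * Real.pi * t) := by
    refine Real.sqrt_le_sqrt ?_
    nlinarith [Real.pi_gt_three]
  have hs0 : 0 < √(t : ℝ) := Real.sqrt_pos.2 ht'
  calc _ ≤ (√(t : ℝ))⁻¹ ^ d * (Real.exp v)⁻¹ * (√d ^ d * √t ^ d * Real.exp v) := by gcongr
    _ = √d ^ d := by
      rw [inv_pow]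
      field_simp

/-- Gaussian upper bounds for balls: one near the origin, and one away from it. -/
theorem exists_heatLaw_ball_le (d : ℕ) (hd : 1 ≤ d) : ∃ C : ℝ, 0 < C ∧ ∀ (t : ℝ≥0), 0 < t →
    ∀ (c : EuclideanSpace ℝ (Fin d)) (r : ℝ), 0 < r →
      (heatLaw d t).real (Metric.ball c r) ≤ C * r ^ d / √(r ^ 2 + t) ^ d ∧
      (2 * r ≤ ‖c‖ → (heatLaw d t).real (Metric.ball c r) ≤ C * r ^ d / √(‖c‖ ^ 2 + t) ^ d) := by
  set V := volume.real (Metric.ball (0 : EuclideanSpace ℝ (Fin d)) 1) with hV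
  have hV0 : 0 < V := volume_real_unitBall_pos d
  -- The summand `1` serves the case `t ≤ r ^ 2`, where the probability is merely bounded by `1`;
  -- the other summand is the kernel bound times the volume.
  refine ⟨2 ^ d * (1 + √d ^ d * V), by positivity, fun t ht c r hr => ?_⟩
  have ht' : (0 : ℝ) < t := ht
  have hst : 0 < √(t : ℝ) := Real.sqrt_pos.2 ht'
  have hgen : ∀ ρ a : ℝ, 0 < ρ → 0 < a → a ≤ 2 * ρ →
      (∀ x ∈ Metric.ball c r, ρ ≤ √(‖x‖ ^ 2 + t)) →
      (heatLaw d t).real (Metric.ball c r) ≤ 2 ^ d * (1 + √d ^ d * V) * r ^ d / a ^ d := by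
    intro ρ a hρ ha haρ hx
    have h := heatLaw_le_of_heatKernel_le ht.ne' (measurableSet_ball (x := c) (ε := r))
      measure_ball_lt_top.ne (A := √d ^ d / ρ ^ d) (by positivity) fun x hxb =>
        (heatKernel_le hd ht x).trans (by have := hx x hxb; gcongr)
    rw [volume_real_ball c hr, ← hV] at h
    refine h.trans ?_
    rw [div_mul_eq_mul_div, div_le_div_iff₀ (by positivity) (by positivity)]
    have h2 : a ^ d ≤ 2 ^ d * ρ ^ d := by rw [← mul_pow]; gcongr
    calc _ ≤ √d ^ d * (r ^ d * V) * (2 ^ d * ρ ^ d) := by gcongr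
      _ = 2 ^ d * (0 + √d ^ d * V) * r ^ d * ρ ^ d := by ring
      _ ≤ _ := by gcongr; norm_num
  constructor
  · have hpos : 0 < √(r ^ 2 + t) := Real.sqrt_pos.2 (by positivity)
    rcases le_or_gt (t : ℝ) (r ^ 2) with h | h
    · refine measureReal_le_one.trans ?_
      rw [one_le_div (by positivity)]
      have : √(r ^ 2 + t) ≤ 2 * r := Real.sqrt_le_iff.2 ⟨by positivity, by nlinarith⟩
      calc √(r ^ 2 + t) ^ d ≤ (2 * r) ^ d := by gcongr
        _ = 2 ^ d * (1 + 0) * r ^ d := by ring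
        _ ≤ _ := by gcongr; positivity
    · refine hgen (√t) _ hst hpos ?_ fun x _ => Real.sqrt_le_sqrt (by nlinarith [norm_nonneg x])
      refine Real.sqrt_le_iff.2 ⟨by positivity, ?_⟩
      rw [mul_pow, Real.sq_sqrt ht'.le]
      linarith
  · intro hc
    have hpos : 0 < √(‖c‖ ^ 2 + t) := Real.sqrt_pos.2 (by positivity)
    refine hgen (√(‖c‖ ^ 2 + t) / 2) _ (by positivity) hpos (by linarith) fun x hx => ?_
    have h1 : ‖c‖ / 2 ≤ ‖x‖ := by
      have h2 : ‖c‖ - ‖x‖ ≤ ‖c - x‖ := norm_sub_norm_le c x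
      rw [Metric.mem_ball, dist_eq_norm, norm_sub_rev] at hx
      linarith
    refine Real.le_sqrt_of_sq_le ?_
    rw [div_pow, Real.sq_sqrt (by positivity)]
    nlinarith [norm_nonneg c]

/-- Gaussian lower bound for balls at the diffusive time scale. -/
theorem exists_le_heatLaw_ball (d : ℕ) : ∃ C : ℝ, 0 < C ∧ ∀ (t : ℝ≥0)
    (c : EuclideanSpace ℝ (Fin d)) (r : ℝ), 0 < r → r ≤ ‖c‖ → ‖c‖ ^ 2 ≤ t → t ≤ 4 * ‖c‖ ^ 2 →
      C * r ^ d / ‖c‖ ^ d ≤ (heatLaw d t).real (Metric.ball c r) := by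
  set V := volume.real (Metric.ball (0 : EuclideanSpace ℝ (Fin d)) 1) with hV
  have hV0 : 0 < V := volume_real_unitBall_pos d
  refine ⟨(√(8 * Real.pi))⁻¹ ^ d * Real.exp (-2) * V, by positivity, fun t c r hr hrc ht1 ht2 => ?_⟩
  have hc : 0 < ‖c‖ := hr.trans_le hrc
  have ht' : (0 : ℝ) < t := lt_of_lt_of_le (by positivity) ht1
  have h := le_heatLaw_of_le_heatKernel (d := d) (t := t) (by exact_mod_cast ht'.ne')
    (measurableSet_ball (x := c) (ε := r)) (A := (√(8 * Real.pi) * ‖c‖)⁻¹ ^ d * Real.exp (-2))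
    (by positivity) fun x hx => by
      have hx2 : ‖x‖ ≤ 2 * ‖c‖ := by
        have h2 : ‖x‖ - ‖c‖ ≤ ‖x - c‖ := norm_sub_norm_le x c
        rw [Metric.mem_ball, dist_eq_norm] at hx
        linarith
      unfold heatKernel
      gcongr
      · refine Real.sqrt_le_iff.2 ⟨by positivity, ?_⟩
        rw [mul_pow, Real.sq_sqrt (by positivity)]
        nlinarith [Real.pi_pos]
      · rw [le_div_iff₀ (by positivity)]
        nlinarith [norm_nonneg x]
  rw [volume_real_ball c hr, ← hV] at h
  refine le_trans (le_of_eq ?_) h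
  rw [mul_inv, mul_pow, inv_pow ‖c‖]
  field_simp

/-- A right-endpoint Riemann sum for `∫ (a² + t)^(-d/2) dt`. For `d = 3` it telescopes against the
antiderivative `-2 (a² + t)^(-1/2)`; in higher dimension the extra factors are at most `1 / a ^ (d -
3)`. The bound is uniform in the step and the horizon. -/
theorem sum_inv_sqrt_pow_le {d : ℕ} (hd : 3 ≤ d) {a h : ℝ} (ha : 0 < a) (hh : 0 < h) (K : ℕ) :
    ∑ k ∈ Finset.range K, h * (√(a ^ 2 + (k + 1) * h) ^ d)⁻¹ ≤ 2 / a ^ (d - 2) := by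
  have step : ∀ u v : ℝ, 0 < u → u ≤ v → v ^ 2 = u ^ 2 + h →
      h * (v ^ 3)⁻¹ ≤ 2 * (u⁻¹ - v⁻¹) := by
    intro u v hu huv hv
    have hv0 : 0 < v := hu.trans_le huv
    have e : u⁻¹ - v⁻¹ = (v - u) / (u * v) := by field_simp
    have e2 : h = (v - u) * (v + u) := by linarith
    rw [e, e2, ← div_eq_mul_inv, ← mul_div_assoc, div_le_div_iff₀ (by positivity) (by positivity)]
    have : (v + u) * u ≤ 2 * v ^ 2 := by nlinarith
    calc (v - u) * (v + u) * (u * v) = (v - u) * v * ((v + u) * u) := by ring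
      _ ≤ (v - u) * v * (2 * v ^ 2) := by
        have := sub_nonneg.2 huv
        gcongr
      _ = _ := by ring
  have tele : ∑ k ∈ Finset.range K, h * (√(a ^ 2 + (k + 1) * h) ^ 3)⁻¹
      ≤ 2 * (a⁻¹ - (√(a ^ 2 + K * h))⁻¹) := by
    induction K with
    | zero => simp [Real.sqrt_sq ha.le]
    | succ K ih =>
      rw [Finset.sum_range_succ]
      have := step (√(a ^ 2 + K * h)) (√(a ^ 2 + (K + 1) * h)) (Real.sqrt_pos.2 (by positivity))
        (Real.sqrt_le_sqrt (by linarith))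
        (by rw [Real.sq_sqrt (by positivity), Real.sq_sqrt (by positivity)]; ring)
      push_cast
      linarith
  have hle : ∀ k : ℕ, h * (√(a ^ 2 + (k + 1) * h) ^ d)⁻¹
      ≤ (a ^ (d - 3))⁻¹ * (h * (√(a ^ 2 + (k + 1) * h) ^ 3)⁻¹) := by
    intro k
    have hs : a ≤ √(a ^ 2 + (k + 1) * h) := Real.le_sqrt_of_sq_le (by
      have : 0 ≤ ((k : ℝ) + 1) * h := by positivity
      linarith)
    obtain ⟨e, rfl⟩ : ∃ e, d = e + 3 := ⟨d - 3, by omega⟩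
    simp only [Nat.add_sub_cancel]
    rw [pow_add, mul_inv, mul_left_comm]
    gcongr
  refine (Finset.sum_le_sum fun k _ => hle k).trans ?_
  rw [← Finset.mul_sum]
  have hK : (0 : ℝ) ≤ (√(a ^ 2 + K * h))⁻¹ := by positivity
  calc _ ≤ (a ^ (d - 3))⁻¹ * (2 * a⁻¹) := by
        gcongr
        linarith
    _ = _ := by
      obtain ⟨e, rfl⟩ : ∃ e, d = e + 3 := ⟨d - 3, by omega⟩
      rw [Nat.add_sub_cancel, show e + 3 - 2 = e + 1 by omega, pow_succ]
      field_simp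

end HeatKernel

/-! ### Second moment method for the sampled process -/

section SecondMoment

variable {Ω : Type*} [MeasurableSpace Ω] {P : Measure Ω} [IsProbabilityMeasure P] {d : ℕ}
  {B : ℝ≥0 → Ω → EuclideanSpace ℝ (Fin d)}

/-- Cross terms are grouped by the earlier index, so that the Markov property at that time bounds
all later ones together. -/
theorem _root_.Finset.sum_range_sq {R : Type*} [CommRing R] (a : ℕ → R) (K : ℕ) :
    (∑ k ∈ Finset.range K, a k) ^ 2 = ∑ j ∈ Finset.range K,
      (a j ^ 2 + 2 * ∑ i ∈ Finset.range (K - (j + 1)), a j * a (j + 1 + i)) := by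
  induction K with
  | zero => simp
  | succ K ih =>
    have : ∀ j ∈ Finset.range K,
        (a j ^ 2 + 2 * ∑ i ∈ Finset.range (K + 1 - (j + 1)), a j * a (j + 1 + i)) =
        (a j ^ 2 + 2 * ∑ i ∈ Finset.range (K - (j + 1)), a j * a (j + 1 + i)) + 2 * (a j * a K) := by
      intro j hj
      have hj' := Finset.mem_range.1 hj
      rw [show K + 1 - (j + 1) = (K - (j + 1)) + 1 by omega, Finset.sum_range_succ,
        show j + 1 + (K - (j + 1)) = K by omega]
      ring
    rw [Finset.sum_range_succ, add_sq, Finset.sum_range_succ _ K, Finset.sum_congr rfl this,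
      Finset.sum_add_distrib, ← ih, ← Finset.mul_sum, ← Finset.sum_mul]
    simp
    ring

theorem integral_mul_eq_of_indep_increment (hm : ∀ t, Measurable (B t))
    (hlaw : ∀ s u, P.map (fun ω => B (s + u) ω - B s ω) = heatLaw d u)
    (hindep : ∀ s u, IndepFun (B s) (fun ω => B (s + u) ω - B s ω) P)
    {f : EuclideanSpace ℝ (Fin d) → ℝ} (hf : Measurable f) {A : ℝ} (hA : ∀ x, |f x| ≤ A)
    (s u : ℝ≥0) :
    ∫ ω, f (B s ω) * f (B (s + u) ω) ∂P
      = ∫ ω, f (B s ω) * ∫ z, f (B s ω + z) ∂heatLaw d u ∂P := by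
  have hA0 : 0 ≤ A := (abs_nonneg _).trans (hA 0)
  have hW : Measurable fun ω => B (s + u) ω - B s ω := (hm _).sub (hm _)
  have hpair := (indepFun_iff_map_prod_eq_prod_map_map (hm s).aemeasurable hW.aemeasurable).1
    (hindep s u)
  rw [hlaw] at hpair
  have hprob : IsProbabilityMeasure (P.map (B s)) :=
    Measure.isProbabilityMeasure_map (hm s).aemeasurable
  have hφ : Measurable fun p : EuclideanSpace ℝ (Fin d) × EuclideanSpace ℝ (Fin d) =>
      f p.1 * f (p.1 + p.2) := by fun_prop
  have h1 : ∫ ω, f (B s ω) * f (B (s + u) ω) ∂P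
      = ∫ p, f p.1 * f (p.1 + p.2) ∂(P.map fun ω => (B s ω, B (s + u) ω - B s ω)) := by
    rw [integral_map ((hm s).prodMk hW).aemeasurable hφ.aestronglyMeasurable]
    simp
  have hint : Integrable (fun p : EuclideanSpace ℝ (Fin d) × EuclideanSpace ℝ (Fin d) =>
      f p.1 * f (p.1 + p.2)) ((P.map (B s)).prod (heatLaw d u)) := by
    refine Integrable.of_bound hφ.aestronglyMeasurable (A * A) (ae_of_all _ fun p => ?_)
    rw [Real.norm_eq_abs, abs_mul]
    exact mul_le_mul (hA _) (hA _) (abs_nonneg _) hA0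
  have hq : StronglyMeasurable fun y => ∫ z, f y * f (y + z) ∂heatLaw d u :=
    hφ.stronglyMeasurable.integral_prod_right
  rw [h1, hpair, integral_prod _ hint,
    integral_map (hm s).aemeasurable hq.aestronglyMeasurable]
  simp_rw [integral_const_mul]

/-- Second moment bound: if `f` is supported where its discretized potential is at most `D`, then
the skeleton of `B` visits the support of `f` with probability at least a multiple of the potential
at the origin. -/
theorem le_prob_hit_support (hm : ∀ t, Measurable (B t)) (hlaw₀ : ∀ t, P.map (B t) = heatLaw d t)
    (hlaw : ∀ s u, P.map (fun ω => B (s + u) ω - B s ω) = heatLaw d u)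
    (hindep : ∀ s u, IndepFun (B s) (fun ω => B (s + u) ω - B s ω) P)
    {f : EuclideanSpace ℝ (Fin d) → ℝ} (hf : Measurable f) (hf0 : ∀ x, 0 ≤ f x) {A : ℝ}
    (hA : ∀ x, f x ≤ A) (h : ℝ≥0) (hhA : h * A ≤ 1) (K : ℕ) {D : ℝ} (hD0 : 0 ≤ D)
    (hD : ∀ y, f y ≠ 0 →
      ∑ k ∈ Finset.range K, h * ∫ z, f (y + z) ∂heatLaw d ((k + 1) * h) ≤ D) :
    (∑ k ∈ Finset.range K, h * ∫ z, f z ∂heatLaw d ((k + 1) * h)) / (1 + 2 * D)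
      ≤ P.real {ω | ∃ k < K, f (B ((k + 1) * h) ω) ≠ 0} := by
  have habs : ∀ x, |f x| ≤ A := fun x => by rw [abs_of_nonneg (hf0 x)]; exact hA x
  have hA0 : 0 ≤ A := (hf0 0).trans (hA 0)
  have hh0 : (0 : ℝ) ≤ h := h.2
  set a : ℕ → Ω → ℝ := fun k ω => h * f (B ((k + 1) * h) ω) with ha
  have ha_meas : ∀ k, Measurable (a k) := fun k => (hf.comp (hm _)).const_mul _
  have ha0 : ∀ k ω, 0 ≤ a k ω := fun k ω => mul_nonneg hh0 (hf0 _)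
  -- With `a k ≤ 1`, the diagonal terms satisfy `a k ^ 2 ≤ a k`; this is the `1` in `1 + 2 * D`.
  have ha1 : ∀ k ω, a k ω ≤ 1 := fun k ω => (mul_le_mul_of_nonneg_left (hA _) hh0).trans hhA
  have haI : ∀ k, Integrable (a k) P := fun k =>
    Integrable.of_bound (ha_meas k).aestronglyMeasurable 1 (ae_of_all _ fun ω => by
      rw [Real.norm_eq_abs, abs_of_nonneg (ha0 k ω)]; exact ha1 k ω)
  have haaI : ∀ j k, Integrable (fun ω => a j ω * a k ω) P := fun j k =>
    Integrable.of_bound ((ha_meas j).mul (ha_meas k)).aestronglyMeasurable 1 (ae_of_all _ fun ω => by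
      rw [Real.norm_eq_abs, abs_of_nonneg (mul_nonneg (ha0 j ω) (ha0 k ω))]
      exact mul_le_one₀ (ha1 j ω) (ha0 k ω) (ha1 k ω))
  set Z : Ω → ℝ := fun ω => ∑ k ∈ Finset.range K, a k ω with hZ
  have hZI : Integrable Z P := integrable_finsetSum _ fun k _ => haI k
  have hEa : ∀ k, ∫ ω, a k ω ∂P = h * ∫ z, f z ∂heatLaw d ((k + 1) * h) := by
    intro k
    rw [ha, integral_const_mul, ← hlaw₀, integral_map (hm _).aemeasurable hf.aestronglyMeasurable]
  have hEZ : ∫ ω, Z ω ∂P = ∑ k ∈ Finset.range K, h * ∫ z, f z ∂heatLaw d ((k + 1) * h) := by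
    rw [hZ, integral_finsetSum _ fun k _ => haI k]
    exact Finset.sum_congr rfl fun k _ => hEa k
  set q : ℕ → EuclideanSpace ℝ (Fin d) → ℝ :=
    fun i y => h * ∫ z, f (y + z) ∂heatLaw d ((i + 1) * h) with hq
  have hq0 : ∀ i y, 0 ≤ q i y := fun i y => mul_nonneg hh0 (integral_nonneg fun z => hf0 _)
  have hq_meas : ∀ i, Measurable (q i) := by
    intro i
    have hφ : Measurable fun p : EuclideanSpace ℝ (Fin d) × EuclideanSpace ℝ (Fin d) =>
      f (p.1 + p.2) := by fun_prop
    exact (hφ.stronglyMeasurable.integral_prod_right (ν := heatLaw d ((i + 1) * h))).measurable.const_mul _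
  have hq1 : ∀ i y, q i y ≤ 1 := by
    intro i y
    refine le_trans (mul_le_mul_of_nonneg_left ?_ hh0) hhA
    calc ∫ z, f (y + z) ∂heatLaw d ((i + 1) * h) ≤ ∫ _, A ∂heatLaw d ((i + 1) * h) := by
          refine integral_mono_of_nonneg (ae_of_all _ fun z => hf0 _) (integrable_const _)
            (ae_of_all _ fun z => hA _)
      _ = A := by simp
  have haqI : ∀ j i, Integrable (fun ω => a j ω * q i (B ((j + 1) * h) ω)) P := fun j i =>
    Integrable.of_bound ((ha_meas j).mul ((hq_meas i).comp (hm _))).aestronglyMeasurable 1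
      (ae_of_all _ fun ω => by
        rw [Real.norm_eq_abs, abs_of_nonneg (mul_nonneg (ha0 j ω) (hq0 i _))]
        exact mul_le_one₀ (ha1 j ω) (hq0 i _) (hq1 i _))
  have hcross : ∀ j i : ℕ, ∫ ω, a j ω * a (j + 1 + i) ω ∂P
      = ∫ ω, a j ω * q i (B ((j + 1) * h) ω) ∂P := by
    intro j i
    have e := integral_mul_eq_of_indep_increment hm hlaw hindep hf habs ((j + 1) * h) ((i + 1) * h)
    have et : (((j + 1 + i : ℕ) : ℝ≥0) + 1) * h = (j + 1) * h + (i + 1) * h := by push_cast; ring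
    calc _ = (h : ℝ) ^ 2 * ∫ ω, f (B ((j + 1) * h) ω) * f (B ((j + 1) * h + (i + 1) * h) ω) ∂P := by
          rw [← integral_const_mul]
          refine integral_congr_ae (ae_of_all _ fun ω => ?_)
          simp only [ha]
          rw [et]; ring
      _ = _ := by
          rw [e, ← integral_const_mul]
          refine integral_congr_ae (ae_of_all _ fun ω => ?_)
          simp only [ha, hq]
          ring
  have htail : ∀ j, ∑ i ∈ Finset.range (K - (j + 1)), ∫ ω, a j ω * a (j + 1 + i) ω ∂P
      ≤ D * ∫ ω, a j ω ∂P := by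
    intro j
    simp_rw [hcross]
    rw [← integral_finsetSum _ fun i _ => haqI j i, ← integral_const_mul]
    refine integral_mono (integrable_finsetSum _ fun i _ => haqI j i) ((haI j).const_mul _)
      fun ω => ?_
    simp only []
    rw [← Finset.mul_sum, mul_comm D]
    -- The bound `D` is known only on the support of `f`; off it the factor `a j` vanishes.
    by_cases hz : f (B ((j + 1) * h) ω) = 0
    · simp [ha, hz]
    · refine mul_le_mul_of_nonneg_left (le_trans ?_ (hD _ hz)) (ha0 j ω)
      exact Finset.sum_le_sum_of_subset_of_nonneg (Finset.range_mono (by omega))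
        fun i _ _ => hq0 i _
  have hZ2I : Integrable (fun ω => Z ω ^ 2) P := by
    simp only [hZ, pow_two, Finset.sum_mul_sum]
    exact integrable_finsetSum _ fun j _ => integrable_finsetSum _ fun k _ => haaI j k
  have hEZ2 : ∫ ω, Z ω ^ 2 ∂P ≤ (1 + 2 * D) * ∫ ω, Z ω ∂P := by
    have e : ∀ ω, Z ω ^ 2 = ∑ j ∈ Finset.range K,
        (a j ω * a j ω + 2 * ∑ i ∈ Finset.range (K - (j + 1)), a j ω * a (j + 1 + i) ω) := by
      intro ω
      rw [hZ, Finset.sum_range_sq]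
      simp_rw [pow_two]
    have hI : ∀ j, Integrable (fun ω => a j ω * a j ω +
        2 * ∑ i ∈ Finset.range (K - (j + 1)), a j ω * a (j + 1 + i) ω) P := fun j =>
      (haaI j j).add ((integrable_finsetSum _ fun i _ => haaI j (j + 1 + i)).const_mul 2)
    simp_rw [e]
    rw [integral_finsetSum _ fun j _ => hI j, hZ,
      integral_finsetSum _ fun k _ => haI k, Finset.mul_sum]
    refine Finset.sum_le_sum fun j _ => ?_
    rw [integral_add (haaI j j)
      ((integrable_finsetSum _ fun i _ => haaI j (j + 1 + i)).const_mul 2), integral_const_mul,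
      integral_finsetSum _ fun i _ => haaI j (j + 1 + i)]
    have h1 : ∫ ω, a j ω * a j ω ∂P ≤ ∫ ω, a j ω ∂P :=
      integral_mono (haaI j j) (haI j) fun ω => mul_le_of_le_one_right (ha0 j ω) (ha1 j ω)
    linarith [htail j]
  set H : Set Ω := {ω | ∃ k < K, f (B ((k + 1) * h) ω) ≠ 0} with hH
  have hH_meas : MeasurableSet H := by
    have : H = ⋃ k ∈ Finset.range K, {ω | f (B ((k + 1) * h) ω) = 0}ᶜ := by
      ext ω; simp [hH]
    rw [this]
    exact Finset.measurableSet_biUnion _ fun k _ =>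
      (measurableSet_eq_fun (hf.comp (hm _)) measurable_const).compl
  set b := 1 + 2 * D with hb
  have hb0 : 0 < b := by positivity
  -- This replaces Cauchy–Schwarz: the left side is `1 - (1 - Z / b) ^ 2`, at most `1` and zero
  -- where `Z = 0`. Its integral is at least `E Z / b` because `E Z² ≤ b E Z`.
  have hpt : ∀ ω, 2 / b * Z ω - 1 / b ^ 2 * Z ω ^ 2 ≤ H.indicator (fun _ => (1 : ℝ)) ω := by
    intro ω
    by_cases hω : ω ∈ H
    · rw [Set.indicator_of_mem hω]
      have : 1 - (2 / b * Z ω - 1 / b ^ 2 * Z ω ^ 2) = (1 - Z ω / b) ^ 2 := by field_simp; ring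
      nlinarith [sq_nonneg (1 - Z ω / b)]
    · rw [Set.indicator_of_notMem hω]
      have hz : Z ω = 0 := by
        refine Finset.sum_eq_zero fun k hk => ?_
        have : f (B ((k + 1) * h) ω) = 0 := by
          by_contra hne
          exact hω ⟨k, Finset.mem_range.1 hk, hne⟩
        simp [ha, this]
      simp [hz]
  have hfin := integral_mono ((hZI.const_mul (2 / b)).sub (hZ2I.const_mul (1 / b ^ 2)))
    ((integrable_const (1 : ℝ)).indicator hH_meas) hpt
  rw [integral_indicator hH_meas, setIntegral_const, smul_eq_mul, mul_one,
    integral_sub' (hZI.const_mul (2 / b)) (hZ2I.const_mul (1 / b ^ 2)), integral_const_mul,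
    integral_const_mul] at hfin
  rw [← hEZ]
  refine le_trans ?_ hfin
  have : 1 / b ^ 2 * ∫ ω, Z ω ^ 2 ∂P ≤ 1 / b ^ 2 * (b * ∫ ω, Z ω ∂P) := by gcongr
  have e : 1 / b ^ 2 * (b * ∫ ω, Z ω ∂P) = (∫ ω, Z ω ∂P) / b := by field_simp
  rw [e] at this
  have e2 : 2 / b * ∫ ω, Z ω ∂P = (∫ ω, Z ω ∂P) / b + (∫ ω, Z ω ∂P) / b := by field_simp; ring
  linarith

end SecondMoment

/-! ### Discretized Green function of a ball -/

section GreenFunction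

/-- The expected discretized occupation time of a ball by Brownian motion from the origin. -/
noncomputable def discreteGreen (d : ℕ) (h : ℝ≥0) (K : ℕ) (c : EuclideanSpace ℝ (Fin d)) (r : ℝ) :
    ℝ :=
  ∑ k ∈ Finset.range K, h * (heatLaw d ((k + 1) * h)).real (Metric.ball c r)

theorem exists_discreteGreen_le (d : ℕ) (hd : 3 ≤ d) : ∃ C : ℝ, 0 < C ∧ ∀ (h : ℝ≥0), 0 < h →
    ∀ (K : ℕ) (c : EuclideanSpace ℝ (Fin d)) (r : ℝ), 0 < r →
      discreteGreen d h K c r ≤ C * r ^ 2 ∧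
      (2 * r ≤ ‖c‖ → discreteGreen d h K c r ≤ C * r ^ 2 * (r / ‖c‖) ^ (d - 2)) := by
  obtain ⟨C, hC, hb⟩ := exists_heatLaw_ball_le d (by omega)
  have hrd : ∀ r : ℝ, r ^ d = r ^ 2 * r ^ (d - 2) := fun r => by
    rw [← pow_add]; congr 1; omega
  refine ⟨2 * C, by positivity, fun h hh K c r hr => ?_⟩
  have key : ∀ a : ℝ, 0 < a → (∀ t : ℝ≥0, 0 < t →
      (heatLaw d t).real (Metric.ball c r) ≤ C * r ^ d / √(a ^ 2 + t) ^ d) →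
      discreteGreen d h K c r ≤ 2 * C * r ^ 2 * (r / a) ^ (d - 2) := by
    intro a ha hbd
    have hs := sum_inv_sqrt_pow_le hd ha (show (0 : ℝ) < h from hh) K
    calc discreteGreen d h K c r ≤ ∑ k ∈ Finset.range K,
          C * r ^ d * (h * (√(a ^ 2 + (k + 1) * h) ^ d)⁻¹) := by
          refine Finset.sum_le_sum fun k _ => ?_
          have := hbd ((k + 1) * h) (by positivity)
          push_cast at this
          rw [mul_left_comm, ← div_eq_mul_inv]
          gcongr
      _ ≤ C * r ^ d * (2 / a ^ (d - 2)) := by rw [← Finset.mul_sum]; gcongr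
      _ = _ := by rw [hrd, div_pow]; ring
  constructor
  · have := key r hr fun t ht => (hb t ht c r hr).1
    rwa [div_self hr.ne', one_pow, mul_one] at this
  · exact fun hc => key ‖c‖ (by linarith) fun t ht => (hb t ht c r hr).2 hc

theorem exists_le_discreteGreen (d : ℕ) (hd : 3 ≤ d) : ∃ C : ℝ, 0 < C ∧ ∀ (h : ℝ≥0), 0 < h →
    ∀ (c : EuclideanSpace ℝ (Fin d)) (r : ℝ), 0 < r → r ≤ ‖c‖ → h ≤ ‖c‖ ^ 2 → ∃ K₀ : ℕ, ∀ K ≥ K₀,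
      C * r ^ 2 * (r / ‖c‖) ^ (d - 2) ≤ discreteGreen d h K c r := by
  obtain ⟨C, hC, hb⟩ := exists_le_heatLaw_ball d
  refine ⟨C, hC, fun h hh c r hr hrc hhc => ?_⟩
  have hh' : (0 : ℝ) < h := hh
  have hc : 0 < ‖c‖ := hr.trans_le hrc
  -- The indices from `k₀` to `2 * k₀ - 1` give sampling times in `[‖c‖², 4 ‖c‖²]`, of total length
  -- `k₀ * h ≥ ‖c‖²`.
  set k₀ := ⌈‖c‖ ^ 2 / h⌉₊ with hk₀
  have hk1 : ‖c‖ ^ 2 ≤ k₀ * h := by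
    rw [← div_le_iff₀ hh']; exact Nat.le_ceil _
  have hk2 : k₀ * h ≤ 2 * ‖c‖ ^ 2 := by
    have := (Nat.ceil_lt_add_one (show 0 ≤ ‖c‖ ^ 2 / (h : ℝ) by positivity)).le
    rw [← hk₀] at this
    calc (k₀ : ℝ) * h ≤ (‖c‖ ^ 2 / h + 1) * h := by gcongr
      _ = ‖c‖ ^ 2 + h := by field_simp
      _ ≤ _ := by linarith
  refine ⟨2 * k₀, fun K hK => ?_⟩
  calc C * r ^ 2 * (r / ‖c‖) ^ (d - 2) = ‖c‖ ^ 2 * (C * r ^ d / ‖c‖ ^ d) := by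
        obtain ⟨e, rfl⟩ : ∃ e, d = e + 2 := ⟨d - 2, by omega⟩
        rw [Nat.add_sub_cancel, pow_add, pow_add, div_pow]
        field_simp
    _ ≤ k₀ * h * (C * r ^ d / ‖c‖ ^ d) := by gcongr
    _ = ∑ k ∈ Finset.Ico k₀ (2 * k₀), h * (C * r ^ d / ‖c‖ ^ d) := by
        simp [two_mul, mul_assoc]
    _ ≤ ∑ k ∈ Finset.Ico k₀ (2 * k₀), h * (heatLaw d ((k + 1) * h)).real (Metric.ball c r) := by
        refine Finset.sum_le_sum fun k hk => ?_
        have hk' := Finset.mem_Ico.1 hk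
        have e1 : (k₀ : ℝ) ≤ k := by exact_mod_cast hk'.1
        have e2 : (k : ℝ) + 1 ≤ 2 * k₀ := by exact_mod_cast hk'.2
        refine mul_le_mul_of_nonneg_left (hb ((k + 1) * h) c r hr hrc ?_ ?_) hh'.le
        · push_cast
          nlinarith
        · push_cast
          nlinarith
    _ ≤ _ := by
        refine Finset.sum_le_sum_of_subset_of_nonneg ?_ fun k _ _ => by positivity
        intro k hk
        have hk' := Finset.mem_Ico.1 hk
        exact Finset.mem_range.2 (by omega)

end GreenFunction

/-! ### Finite-dimensional laws and the weak Markov property -/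

section PreBrownian

variable {Ω : Type*} [MeasurableSpace Ω] {P : Measure Ω} {d : ℕ}
  {B : ℝ≥0 → Ω → EuclideanSpace ℝ (Fin d)}

/-- A measurable process with the finite-dimensional laws of `d`-dimensional Brownian motion. -/
structure IsPreBrownianMotion (B : ℝ≥0 → Ω → EuclideanSpace ℝ (Fin d)) (P : Measure Ω) : Prop where
  measurable : ∀ t, Measurable (B t)
  coord : ∀ i : Fin d, IsPreBrownianReal (fun t ω => B t ω i) P
  indep : iIndepFun (fun (i : Fin d) (ω : Ω) (t : ℝ≥0) => B t ω i) P

/-- Brownian motion has a modification with measurable marginals. -/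
theorem IsBrownianMotion.exists_modification (hB : IsBrownianMotion B P) :
    ∃ B', IsPreBrownianMotion B' P ∧ ∀ t, B t =ᵐ[P] B' t := by
  have hm : ∀ (i : Fin d) t, AEMeasurable (fun ω => B t ω i) P := fun i t =>
    (hB.coord i).toIsPreBrownianReal.aemeasurable t
  refine ⟨fun t ω => WithLp.toLp 2 fun i => (hm i t).mk _ ω, ⟨fun t => ?_, fun i => ?_, ?_⟩,
    fun t => ?_⟩
  · have : ∀ i, Measurable ((hm i t).mk _) := fun i => (hm i t).measurable_mk
    fun_prop
  · exact (hB.coord i).toIsPreBrownianReal.congr fun t => (hm i t).ae_eq_mk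
  · exact hB.indep.process_congr fun i t => (hm i t).ae_eq_mk
  · filter_upwards [ae_all_iff.2 fun i => (hm i t).ae_eq_mk] with ω hω
    ext i
    exact hω i

theorem IsPreBrownianMotion.map_eq (hB : IsPreBrownianMotion B P) (t : ℝ≥0) :
    P.map (B t) = heatLaw d t := by
  have hm : ∀ i, Measurable fun ω => B t ω i := fun i => by have := hB.measurable t; fun_prop
  have hi : iIndepFun (fun (i : Fin d) ω => B t ω i) P :=
    hB.indep.comp (fun _ p => p t) fun _ => measurable_pi_apply t
  have hpi : P.map (fun ω i => B t ω i) = Measure.pi fun _ : Fin d => gaussianReal 0 t := by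
    rw [hi.map_fun_eq_pi_map fun i => (hm i).aemeasurable]
    congr 1
    funext i
    exact ((hB.coord i).hasLaw_eval t).map_eq
  have hm' : Measurable fun ω i => B t ω i := measurable_pi_iff.2 hm
  rw [heatLaw, ← hpi, Measure.map_map (by fun_prop) hm']
  rfl

theorem IsPreBrownianMotion.shift (hB : IsPreBrownianMotion B P) (s : ℝ≥0) :
    IsPreBrownianMotion (fun t ω => B (s + t) ω - B s ω) P where
  measurable t := (hB.measurable _).sub (hB.measurable _)
  coord i := (hB.coord i).shift s
  indep := hB.indep.comp (fun _ p t => p (s + t) - p s) fun _ => by fun_prop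

theorem _root_.ProbabilityTheory.iIndepFun_bool_iff_indepFun {β : Bool → Type*}
    [∀ b, MeasurableSpace (β b)] [IsProbabilityMeasure P] {X : ∀ b, Ω → β b} :
    iIndepFun X P ↔ IndepFun (X true) (X false) P := by
  refine ⟨fun h => h.indepFun (by decide), fun h => ?_⟩
  rw [iIndepFun_iff_measure_inter_preimage_eq_mul]
  intro S sets hS
  by_cases ht : true ∈ S <;> by_cases hf : false ∈ S
  · obtain rfl : S = {true, false} := by ext b; cases b <;> simp [ht, hf]
    rw [Finset.set_biInter_insert, Finset.set_biInter_singleton, Finset.prod_pair (by decide)]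
    exact h.measure_inter_preimage_eq_mul _ _ (hS true ht) (hS false hf)
  · obtain rfl : S = {true} := by ext b; cases b <;> simp [ht, hf]
    simp
  · obtain rfl : S = {false} := by ext b; cases b <;> simp [ht, hf]
    simp
  · obtain rfl : S = ∅ := by ext b; cases b <;> simp [ht, hf]
    simp

/-- Weak Markov property: the increments after time `s` are independent of the path up to `s`. -/
theorem IsPreBrownianMotion.indepFun_shift [IsProbabilityMeasure P] (hB : IsPreBrownianMotion B P)
    (s : ℝ≥0) :
    IndepFun (fun ω (t : ℝ≥0) => B (s + t) ω - B s ω) (fun ω (t : ℝ≥0) => B (min t s) ω) P := by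
  have hm : ∀ i t, Measurable fun ω => B t ω i := fun i t => by have := hB.measurable t; fun_prop
  let X : Fin d → Bool → Ω → ℝ≥0 → ℝ := fun i b ω t =>
    if b then B (s + t) ω i - B s ω i else B (min t s) ω i
  have mX : ∀ i b, Measurable (X i b) := by
    intro i b
    refine measurable_pi_iff.2 fun t => ?_
    cases b
    · exact hm i (min t s)
    · exact (hm i _).sub (hm i _)
  have h1 : iIndepFun (fun i ω b => X i b ω) P := by
    refine hB.indep.comp
      (fun _ (p : ℝ≥0 → ℝ) (b : Bool) (t : ℝ≥0) => if b then p (s + t) - p s else p (min t s))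
      fun _ => measurable_pi_iff.2 fun b => ?_
    cases b
    · simp only [Bool.false_eq_true, if_false]; fun_prop
    · simp only [if_true]; fun_prop
  have h2 : ∀ i, iIndepFun (X i) P := by
    intro i
    rw [iIndepFun_bool_iff_indepFun]
    exact ((hB.coord i).indepFun_shift s).comp measurable_id
      (ψ := fun (p : Set.Iic s → ℝ) (t : ℝ≥0) => p ⟨min t s, min_le_right t s⟩) (by fun_prop)
  -- Independence across coordinates, together with that of future (`true`) and past (`false`)
  -- within each, makes the whole family over `Fin d × Bool` independent; it is then regrouped by
  -- the Boolean.
  have h3 := (iIndepFun_uncurry' mX h1 h2).indepFun_finset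
    (Finset.univ.filter fun p => p.2 = true) (Finset.univ.filter fun p => p.2 = false)
    (Finset.disjoint_left.2 fun p hp hq => by simp_all) fun p => mX p.1 p.2
  have hglue : ∀ (T : Finset (Fin d × Bool)) (b : Bool) (hT : ∀ i, (i, b) ∈ T),
      Measurable fun (x : T → ℝ≥0 → ℝ) (t : ℝ≥0) =>
        (WithLp.toLp 2 fun i : Fin d => x ⟨(i, b), hT i⟩ t : EuclideanSpace ℝ (Fin d)) :=
    fun T b hT => measurable_pi_iff.2 fun t => by fun_prop
  exact h3.comp (hglue _ true fun i => by simp) (hglue _ false fun i => by simp)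

theorem IsPreBrownianMotion.indepFun_increment [IsProbabilityMeasure P]
    (hB : IsPreBrownianMotion B P) (s u : ℝ≥0) :
    IndepFun (B s) (fun ω => B (s + u) ω - B s ω) P := by
  have := (hB.indepFun_shift s).symm.comp (measurable_pi_apply s) (measurable_pi_apply u)
  simpa [Function.comp_def] using this

end PreBrownian

/-! ### Uniform lower bound for hitting a finite family -/

section UniformHitting

variable {d : ℕ}

theorem measurable_indicator_sum {ι : Type*} (F : Finset ι) (c : ι → EuclideanSpace ℝ (Fin d))
    (r w : ι → ℝ) :
    Measurable fun y => ∑ n ∈ F, w n * (Metric.ball (c n) (r n)).indicator (fun _ => (1 : ℝ)) y :=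
  Finset.measurable_fun_sum _ fun _ _ =>
    (measurable_const.indicator measurableSet_ball).const_mul _

theorem sum_integral_indicator_sum {ι : Type*} (F : Finset ι) (c : ι → EuclideanSpace ℝ (Fin d))
    (r w : ι → ℝ) (h : ℝ≥0) (K : ℕ) (y : EuclideanSpace ℝ (Fin d)) :
    ∑ k ∈ Finset.range K, h * ∫ z, (∑ n ∈ F,
      w n * (Metric.ball (c n) (r n)).indicator (fun _ => (1 : ℝ)) (y + z)) ∂heatLaw d ((k + 1) * h)
      = ∑ n ∈ F, w n * discreteGreen d h K (c n - y) (r n) := by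
  have hind : ∀ n (z : EuclideanSpace ℝ (Fin d)),
      (Metric.ball (c n) (r n)).indicator (fun _ => (1 : ℝ)) (y + z)
        = (Metric.ball (c n - y) (r n)).indicator (fun _ => (1 : ℝ)) z := by
    intro n z
    have : y + z ∈ Metric.ball (c n) (r n) ↔ z ∈ Metric.ball (c n - y) (r n) := by
      rw [Metric.mem_ball, Metric.mem_ball, dist_eq_norm, dist_eq_norm,
        show y + z - c n = z - (c n - y) by abel]
    by_cases hz : z ∈ Metric.ball (c n - y) (r n)
    · rw [Set.indicator_of_mem hz, Set.indicator_of_mem (this.2 hz)]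
    · rw [Set.indicator_of_notMem hz, Set.indicator_of_notMem (mt this.1 hz)]
  have hI : ∀ k : ℕ, ∫ z, (∑ n ∈ F,
      w n * (Metric.ball (c n) (r n)).indicator (fun _ => (1 : ℝ)) (y + z)) ∂heatLaw d ((k + 1) * h)
      = ∑ n ∈ F, w n * (heatLaw d ((k + 1) * h)).real (Metric.ball (c n - y) (r n)) := by
    intro k
    simp_rw [hind]
    rw [integral_finsetSum _ fun n _ =>
      ((integrable_const (1 : ℝ)).indicator measurableSet_ball).const_mul _]
    refine Finset.sum_congr rfl fun n _ => ?_
    rw [integral_const_mul, integral_indicator measurableSet_ball, setIntegral_const]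
    simp
  simp_rw [hI, Finset.mul_sum, discreteGreen, Finset.mul_sum]
  rw [Finset.sum_comm]
  exact Finset.sum_congr rfl fun n _ => Finset.sum_congr rfl fun k _ => by ring

/-- A finite separated family of balls of total size at least `1` seen from the origin is hit at
rational times with probability bounded below. -/
theorem exists_uniform_hit_prob (hd : 3 ≤ d) {ε M : ℝ} (hε : 0 < ε) (hM0 : 0 ≤ M)
    {Ω : Type*} [MeasurableSpace Ω] (P : Measure Ω) [IsProbabilityMeasure P] :
    ∃ δ : ℝ, 0 < δ ∧ ∀ (F : Finset ℕ) (c : ℕ → EuclideanSpace ℝ (Fin d)) (r : ℕ → ℝ),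
      (∀ n ∈ F, 0 < r n) → (∀ n ∈ F, 2 * r n ≤ ε) → (∀ n ∈ F, ε ≤ ‖c n‖) → (∀ n ∈ F, 1 ≤ ‖c n‖) →
      (∀ n ∈ F, ∀ m ∈ F, n ≠ m → 2 * ε ≤ ‖c n - c m‖) →
      (∀ n ∈ F, r n ^ (d - 2) * ‖c n‖ ^ 2 ≤ M) → 1 ≤ ∑ n ∈ F, (r n / ‖c n‖) ^ (d - 2) →
      ∀ B : ℝ≥0 → Ω → EuclideanSpace ℝ (Fin d), IsPreBrownianMotion B P →
      δ ≤ P.real {ω | ∃ k m n : ℕ, B (k / (m + 1)) ω ∈ Metric.ball (c n) (r n)} := by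
  obtain ⟨C, hC, hub⟩ := exists_discreteGreen_le d hd
  obtain ⟨C', hC', hlb⟩ := exists_le_discreteGreen d hd
  obtain ⟨I, hI0, hI⟩ := exists_interaction_bound (ι := ℕ) hd hε hM0
  set Q := C * (1 + 2 ^ (d - 2) * (I + 2 ^ (d - 2))) with hQ
  have hQ0 : 0 < Q := by positivity
  refine ⟨C' / (1 + 2 * Q), by positivity, fun F c r hr hrε hcε hc1 hsep hM hS B hB => ?_⟩
  set S := ∑ n ∈ F, (r n / ‖c n‖) ^ (d - 2) with hSdef
  set A := ∑ n ∈ F, (r n ^ 2)⁻¹ with hA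
  have hA0 : 0 ≤ A := Finset.sum_nonneg fun n _ => by positivity
  -- The weight cancels the factor `r ^ 2` in the Green function of a ball, leaving `(r / ‖c‖) ^ (d
  -- - 2)`.
  set f : EuclideanSpace ℝ (Fin d) → ℝ := fun y =>
    ∑ n ∈ F, (r n ^ 2)⁻¹ * (Metric.ball (c n) (r n)).indicator (fun _ => (1 : ℝ)) y with hf
  obtain ⟨m, hm⟩ := exists_nat_ge A
  -- Small enough that `h * A ≤ 1` and `h ≤ 1 ≤ ‖c n‖ ^ 2`, and rational so that the skeleton times
  -- are rational.
  set h : ℝ≥0 := 1 / (m + 1) with hh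
  have hh0 : 0 < h := by positivity
  have hhr : (h : ℝ) = 1 / (m + 1) := by simp [hh]
  have hh1 : (h : ℝ) ≤ 1 := by
    rw [hhr, div_le_one (by positivity)]; linarith [Nat.cast_nonneg (α := ℝ) m]
  have hhA : h * A ≤ 1 := by
    rw [hhr, one_div_mul_eq_div, div_le_one (by positivity)]; linarith
  have hlow : ∀ᶠ K in Filter.atTop, ∀ n ∈ F,
      C' * r n ^ 2 * (r n / ‖c n‖) ^ (d - 2) ≤ discreteGreen d h K (c n) (r n) := by
    rw [Filter.eventually_all_finset]
    intro n hn
    have h1 := hr n hn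
    have h2 := hrε n hn
    have h3 := hcε n hn
    have h4 := hc1 n hn
    obtain ⟨K₀, hK₀⟩ := hlb h hh0 (c n) (r n) h1 (by linarith) (by nlinarith)
    exact Filter.eventually_atTop.2 ⟨K₀, hK₀⟩
  obtain ⟨K, hK⟩ := hlow.exists
  have hU0 : C' * S ≤ ∑ n ∈ F, (r n ^ 2)⁻¹ * discreteGreen d h K (c n - 0) (r n) := by
    rw [hSdef, Finset.mul_sum]
    refine Finset.sum_le_sum fun n hn => ?_
    have h1 := hr n hn
    rw [sub_zero, ← div_eq_inv_mul, le_div_iff₀ (by positivity)]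
    linarith [hK n hn]
  have hUy : ∀ y, f y ≠ 0 →
      ∑ n ∈ F, (r n ^ 2)⁻¹ * discreteGreen d h K (c n - y) (r n) ≤ Q * S := by
    intro y hy
    obtain ⟨k, hk, hky⟩ := Finset.exists_ne_zero_of_sum_ne_zero hy
    have hyk : y ∈ Metric.ball (c k) (r k) := by
      by_contra hcon
      exact hky (by rw [Set.indicator_of_notMem hcon, mul_zero])
    rw [Metric.mem_ball, dist_eq_norm] at hyk
    rw [← Finset.sum_filter_add_sum_filter_not F fun n => n ≠ k]
    have e1 : ∑ n ∈ F with ¬ n ≠ k, (r n ^ 2)⁻¹ * discreteGreen d h K (c n - y) (r n) ≤ C := by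
      have : F.filter (fun n => ¬ n ≠ k) = {k} := by
        ext n; simp only [ne_eq, not_not, Finset.mem_filter, Finset.mem_singleton]
        exact ⟨fun hn => hn.2, fun hn => ⟨hn ▸ hk, hn⟩⟩
      rw [this, Finset.sum_singleton, ← div_eq_inv_mul, div_le_iff₀ (by have := hr k hk; positivity)]
      exact (hub h hh0 K _ _ (hr k hk)).1
    -- As `y` is within `ε / 2` of `c k` and centres are `2 ε` apart, replacing `y` by `c k` changes
    -- distances by at most a factor `2`.
    have e2 : ∑ n ∈ F with n ≠ k, (r n ^ 2)⁻¹ * discreteGreen d h K (c n - y) (r n)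
        ≤ C * 2 ^ (d - 2) * ∑ n ∈ F with n ≠ k, (r n / ‖c n - c k‖) ^ (d - 2) := by
      rw [Finset.mul_sum]
      refine Finset.sum_le_sum fun n hn => ?_
      obtain ⟨hnF, hnk⟩ := Finset.mem_filter.1 hn
      have h1 := hr n hnF
      have h2 := hrε n hnF
      have h3 := hrε k hk
      have h4 := hsep n hnF k hk hnk
      have h5 : ‖c n - c k‖ ≤ ‖c n - y‖ + ‖y - c k‖ := by
        have := norm_add_le (c n - y) (y - c k)
        rwa [sub_add_sub_cancel] at this
      have h6 := (hub h hh0 K (c n - y) _ h1).2 (by linarith)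
      have hy0 : 0 < ‖c n - y‖ := by linarith
      have hk0 : 0 < ‖c n - c k‖ := by linarith
      rw [← div_eq_inv_mul, div_le_iff₀ (by positivity)]
      refine h6.trans ?_
      have h7 : (r n / ‖c n - y‖) ^ (d - 2) ≤ 2 ^ (d - 2) * (r n / ‖c n - c k‖) ^ (d - 2) := by
        rw [← mul_pow]
        refine pow_le_pow_left₀ (by positivity) ?_ _
        rw [← mul_div_assoc, div_le_div_iff₀ hy0 hk0]
        nlinarith
      calc C * r n ^ 2 * (r n / ‖c n - y‖) ^ (d - 2)
          ≤ C * r n ^ 2 * (2 ^ (d - 2) * (r n / ‖c n - c k‖) ^ (d - 2)) := by gcongr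
        _ = _ := by ring
    have e3 := hI F c r hr hcε hsep hM k hk
    rw [← hSdef] at e3
    have e4 : C * 2 ^ (d - 2) * ∑ n ∈ F with n ≠ k, (r n / ‖c n - c k‖) ^ (d - 2)
        ≤ C * 2 ^ (d - 2) * (I + 2 ^ (d - 2) * S) := by gcongr
    have e5 : C * 2 ^ (d - 2) * I ≤ C * 2 ^ (d - 2) * I * S :=
      le_mul_of_one_le_right (by positivity) hS
    have e6 : C ≤ C * S := le_mul_of_one_le_right hC.le hS
    have e7 : Q * S = C * S + C * 2 ^ (d - 2) * I * S + C * 2 ^ (d - 2) * (2 ^ (d - 2) * S) := by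
      rw [hQ]; ring
    rw [e7]
    linarith
  have main := le_prob_hit_support hB.measurable hB.map_eq (fun s u => (hB.shift s).map_eq u)
    hB.indepFun_increment (f := f) (measurable_indicator_sum F c r _)
    (fun y => Finset.sum_nonneg fun n _ =>
      mul_nonneg (by positivity) (Set.indicator_nonneg (fun _ _ => zero_le_one) _))
    (A := A) (fun y => Finset.sum_le_sum fun n _ => mul_le_of_le_one_right (by positivity)
      (Set.indicator_le_self' (fun _ _ => zero_le_one) _))
    h hhA K (D := Q * S) (by positivity)
    (fun y hy => by rw [hf, sum_integral_indicator_sum]; exact hUy y hy)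
  have e0 := sum_integral_indicator_sum F c r (fun n => (r n ^ 2)⁻¹) h K 0
  simp only [zero_add] at e0
  rw [hf, e0] at main
  have hfrac : C' / (1 + 2 * Q) ≤ C' * S / (1 + 2 * (Q * S)) := by
    rw [div_le_div_iff₀ (by positivity) (by positivity)]
    nlinarith
  calc C' / (1 + 2 * Q) ≤ C' * S / (1 + 2 * (Q * S)) := hfrac
    _ ≤ _ := by gcongr
    _ ≤ _ := main
    _ ≤ _ := by
      refine measureReal_mono ?_
      rintro ω ⟨k, _, hk⟩
      obtain ⟨n, _, hn⟩ := Finset.exists_ne_zero_of_sum_ne_zero hk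
      refine ⟨k + 1, m, n, ?_⟩
      by_contra hcon
      refine hn ?_
      rw [Set.indicator_of_notMem, mul_zero]
      rw [hh, mul_one_div]
      push_cast at hcon
      exact hcon

end UniformHitting

/-! ### Uniform hitting from every point and the zero-one argument -/

section Avoidance

variable {d : ℕ} {Ω : Type*} [MeasurableSpace Ω] {P : Measure Ω}

theorem finite_norm_le_of_separated {ε : ℝ} (hε : 0 < ε) (c : ℕ → EuclideanSpace ℝ (Fin d))
    (hsep : ∀ n m, n ≠ m → 2 * ε ≤ ‖c n - c m‖) (R : ℝ) : {n | ‖c n‖ ≤ R}.Finite := by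
  by_contra hinf
  obtain ⟨N, hN⟩ := exists_nat_gt (((max R 0 + ε) / ε) ^ d)
  obtain ⟨F, hF, hFN⟩ := Set.Infinite.exists_subset_card_eq hinf N
  have := card_le_of_separated hε (le_max_right R 0) F c (fun n _ m _ => hsep n m)
    fun n hn => (hF hn).trans (le_max_left _ _)
  rw [hFN] at this
  linarith

/-- If the sum of relative sizes diverges, the balls are hit at rational times with probability
bounded below uniformly in the starting point. -/
theorem exists_uniform_hit_prob_of_not_summable [IsProbabilityMeasure P] (hd : 3 ≤ d)
    {c : ℕ → EuclideanSpace ℝ (Fin d)} {r : ℕ → ℝ} (hr : ∀ n, 0 < r n) (hsep : Separated c) {M : ℝ}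
    (hM : ∀ n, r n ^ (d - 2) * ‖c n‖ ^ 2 ≤ M)
    (hns : ¬ Summable fun n => (r n / ‖c n‖) ^ (d - 2)) :
    ∃ δ : ℝ, 0 < δ ∧ ∀ (B : ℝ≥0 → Ω → EuclideanSpace ℝ (Fin d)), IsPreBrownianMotion B P →
      ∀ y, δ ≤ P.real {ω | ∃ k m n : ℕ, y + B (k / (m + 1)) ω ∈ Metric.ball (c n) (r n)} := by
  obtain ⟨ε, hε, hsep⟩ := hsep
  have hM0 : 0 ≤ M := le_trans (by have := hr 0; positivity) (hM 0)
  obtain ⟨δ, hδ, H⟩ := exists_uniform_hit_prob hd hε (M := 4 * M) (by positivity) P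
  refine ⟨δ, hδ, fun B hB y => ?_⟩
  -- Beyond `R` the last term forces `r n ≤ ε / 2`, and the others keep `‖c n - y‖` above `1` and
  -- `ε`. Also `‖c n - y‖ ≤ 2 ‖c n‖`, whence the bound `4 * M` and the threshold `2 ^ (d - 2)`
  -- below.
  set R := ‖y‖ + 1 + ε + M / (ε / 2) ^ (d - 2) with hR
  set T := (finite_norm_le_of_separated hε c hsep R).toFinset
  have hq : 0 ≤ M / (ε / 2) ^ (d - 2) := by positivity
  have hT : ∀ n, n ∉ T → R < ‖c n‖ := fun n hn => by simpa [T] using hn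
  have hy := norm_nonneg y
  have hp0 : ∀ n, 0 ≤ (r n / ‖c n‖) ^ (d - 2) := fun n => by have := hr n; positivity
  obtain ⟨F, hFT, hFS⟩ : ∃ F : Finset ℕ, (∀ n ∈ F, n ∉ T) ∧
      2 ^ (d - 2) ≤ ∑ n ∈ F, (r n / ‖c n‖) ^ (d - 2) := by
    by_contra! hcon
    refine hns (summable_of_sum_le (c := ∑ n ∈ T, (r n / ‖c n‖) ^ (d - 2) + 2 ^ (d - 2)) hp0
      fun F => ?_)
    rw [← Finset.sum_filter_add_sum_filter_not F fun n => n ∈ T]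
    refine add_le_add ?_ (hcon _ fun n hn => (Finset.mem_filter.1 hn).2).le
    exact Finset.sum_le_sum_of_subset_of_nonneg (fun n hn => (Finset.mem_filter.1 hn).2)
      fun n _ _ => hp0 n
  have hlow : ∀ n ∈ F, ‖c n‖ - ‖y‖ ≤ ‖c n - y‖ := fun n _ => norm_sub_norm_le _ _
  have hup : ∀ n ∈ F, ‖c n - y‖ ≤ 2 * ‖c n‖ := fun n hn => by
    have h1 := norm_sub_le (c n) y
    have h2 := hT n (hFT n hn)
    linarith
  have hmain := H F (fun n => c n - y) r (fun n _ => hr n) ?_ ?_ ?_ ?_ ?_ ?_ B hB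
  · refine hmain.trans (le_of_eq ?_)
    congr 1
    ext ω
    simp only [Set.mem_ofPred_eq, Metric.mem_ball, dist_eq_norm]
    refine exists_congr fun k => exists_congr fun m => exists_congr fun n => ?_
    rw [show B (k / (m + 1)) ω - (c n - y) = y + B (k / (m + 1)) ω - c n by abel]
  · intro n hn
    have h2 := hT n (hFT n hn)
    have h3 : M / (ε / 2) ^ (d - 2) ≤ ‖c n‖ ^ 2 := by nlinarith
    rw [div_le_iff₀ (by positivity)] at h3
    have hc : 0 < ‖c n‖ := by linarith
    have h4 : r n ^ (d - 2) ≤ (ε / 2) ^ (d - 2) := by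
      refine le_of_mul_le_mul_right ?_ (show 0 < ‖c n‖ ^ 2 by positivity)
      linarith [hM n]
    have := (pow_le_pow_iff_left₀ (hr n).le (by positivity) (by omega)).1 h4
    linarith
  · intro n hn
    linarith [hT n (hFT n hn), hlow n hn]
  · intro n hn
    linarith [hT n (hFT n hn), hlow n hn]
  · intro n _ m _ hnm
    simpa using hsep n m hnm
  · intro n hn
    have := hr n
    calc r n ^ (d - 2) * ‖c n - y‖ ^ 2 ≤ r n ^ (d - 2) * (2 * ‖c n‖) ^ 2 := by
          have := hup n hn
          gcongr
      _ = 4 * (r n ^ (d - 2) * ‖c n‖ ^ 2) := by ring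
      _ ≤ 4 * M := by linarith [hM n]
  · have : ∑ n ∈ F, (r n / ‖c n‖) ^ (d - 2)
        ≤ 2 ^ (d - 2) * ∑ n ∈ F, (r n / ‖c n - y‖) ^ (d - 2) := by
      rw [Finset.mul_sum]
      refine Finset.sum_le_sum fun n hn => ?_
      have h1 := hT n (hFT n hn)
      have h2 := hlow n hn
      have h3 := hr n
      rw [← mul_pow]
      refine pow_le_pow_left₀ (by positivity) ?_ _
      rw [← mul_div_assoc, div_le_div_iff₀ (by linarith) (by linarith)]
      nlinarith [hup n hn]
    have h2 := hFS.trans this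
    exact le_of_mul_le_mul_left (by rwa [mul_one]) (show (0 : ℝ) < 2 ^ (d - 2) by positivity)

/-- The event that the process avoids the open balls at rational times up to `T`. -/
def rationalAvoidEvent (B : ℝ≥0 → Ω → EuclideanSpace ℝ (Fin d))
    (c : ℕ → EuclideanSpace ℝ (Fin d)) (r : ℕ → ℝ) (T : ℝ≥0) : Set Ω :=
  {ω | ∀ k m n : ℕ, (k : ℝ≥0) / (m + 1) ≤ T → B (k / (m + 1)) ω ∉ Metric.ball (c n) (r n)}

theorem measurableSet_rationalAvoidEvent {B : ℝ≥0 → Ω → EuclideanSpace ℝ (Fin d)}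
    (hB : ∀ t, Measurable (B t)) (c : ℕ → EuclideanSpace ℝ (Fin d)) (r : ℕ → ℝ) (T : ℝ≥0) :
    MeasurableSet (rationalAvoidEvent B c r T) := by
  simp only [rationalAvoidEvent, Set.ofPred_forall]
  exact .iInter fun k => .iInter fun m => .iInter fun n => .iInter fun _ =>
    (hB _ measurableSet_ball).compl

/-- By the Markov property at time `T`, a uniform lower bound on hitting probabilities gives a
uniform loss of mass after time `T`. -/
theorem prob_avoid_le_mul [IsProbabilityMeasure P] {B : ℝ≥0 → Ω → EuclideanSpace ℝ (Fin d)}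
    (hB : IsPreBrownianMotion B P) (c : ℕ → EuclideanSpace ℝ (Fin d)) (r : ℕ → ℝ) (T : ℕ) {δ : ℝ}
    (hδ : ∀ y, δ ≤ P.real
      {ω | ∃ k m n : ℕ, y + (B (T + k / (m + 1)) ω - B T ω) ∈ Metric.ball (c n) (r n)}) :
    P (⋂ S : ℕ, rationalAvoidEvent B c r S)
      ≤ ENNReal.ofReal (1 - δ) * P (rationalAvoidEvent B c r T) := by
  set W : Ω → ℝ≥0 → EuclideanSpace ℝ (Fin d) := fun ω t => B (T + t) ω - B T ω with hW
  set V : Ω → ℝ≥0 → EuclideanSpace ℝ (Fin d) := fun ω t => B (min t T) ω with hV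
  have hWm : Measurable W := measurable_pi_iff.2 (hB.shift T).measurable
  have hVm : Measurable V := measurable_pi_iff.2 fun t => hB.measurable _
  have hmap := (indepFun_iff_map_prod_eq_prod_map_map hWm.aemeasurable hVm.aemeasurable).1
    (hB.indepFun_shift T)
  have : IsProbabilityMeasure (P.map W) := Measure.isProbabilityMeasure_map hWm.aemeasurable
  have : IsProbabilityMeasure (P.map V) := Measure.isProbabilityMeasure_map hVm.aemeasurable
  set past : Set (ℝ≥0 → EuclideanSpace ℝ (Fin d)) :=
    rationalAvoidEvent (fun t p => p t) c r T with hpast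
  have hpastm : MeasurableSet past :=
    measurableSet_rationalAvoidEvent (fun t => measurable_pi_apply t) c r T
  set fut : Set ((ℝ≥0 → EuclideanSpace ℝ (Fin d)) × (ℝ≥0 → EuclideanSpace ℝ (Fin d))) :=
    {x | ∀ k m n : ℕ, x.2 T + x.1 (k / (m + 1)) ∉ Metric.ball (c n) (r n)} with hfut
  have hfutm : MeasurableSet fut := by
    simp only [hfut, Set.ofPred_forall]
    refine .iInter fun k => .iInter fun m => .iInter fun n => ?_
    have : Measurable fun x : (ℝ≥0 → EuclideanSpace ℝ (Fin d)) × (ℝ≥0 → EuclideanSpace ℝ (Fin d)) =>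
      x.2 T + x.1 (k / (m + 1)) := by fun_prop
    exact (this measurableSet_ball).compl
  have hpre : V ⁻¹' past = rationalAvoidEvent B c r T := by
    ext ω
    simp only [hpast, rationalAvoidEvent, hV, Set.mem_preimage, Set.mem_ofPred_eq]
    refine forall_congr' fun k => forall_congr' fun m => forall_congr' fun n =>
      forall_congr' fun hk => ?_
    rw [min_eq_left hk]
  have hsub : (⋂ S : ℕ, rationalAvoidEvent B c r S)
      ⊆ (fun ω => (W ω, V ω)) ⁻¹' (fut ∩ Prod.snd ⁻¹' past) := by
    intro ω hω
    rw [Set.mem_iInter] at hω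
    refine ⟨fun k m n => ?_, ?_⟩
    -- As `T` is an integer, shifting by `T` keeps times in the skeleton.
    · have h1 : (T : ℝ≥0) + k / (m + 1) = ((T * (m + 1) + k : ℕ) : ℝ≥0) / (m + 1) := by
        push_cast; field_simp
      obtain ⟨S, hS⟩ := exists_nat_ge (((T * (m + 1) + k : ℕ) : ℝ≥0) / (m + 1))
      have h2 := hω S _ m n hS
      rw [← h1] at h2
      simpa [hV, hW] using h2
    · change ω ∈ V ⁻¹' past
      rw [hpre]
      exact hω T
  have hfib : ∀ p, P.map W {w | (w, p) ∈ fut} ≤ ENNReal.ofReal (1 - δ) := by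
    intro p
    have hm : MeasurableSet {w | (w, p) ∈ fut} := hfutm.preimage measurable_prodMk_right
    rw [Measure.map_apply hWm hm]
    have hcompl : W ⁻¹' {w | (w, p) ∈ fut} =
        {ω | ∃ k m n : ℕ, p T + (B (T + k / (m + 1)) ω - B T ω) ∈ Metric.ball (c n) (r n)}ᶜ := by
      ext ω
      simp [hfut, hW]
    have hm' := hm.preimage hWm
    rw [hcompl] at hm' ⊢
    rw [← ofReal_measureReal, probReal_compl_eq_one_sub hm'.of_compl]
    exact ENNReal.ofReal_le_ofReal (by linarith [hδ (p T)])
  have hset : MeasurableSet (fut ∩ Prod.snd ⁻¹' past) := hfutm.inter (measurable_snd hpastm)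
  calc P (⋂ S : ℕ, rationalAvoidEvent B c r S)
      ≤ P ((fun ω => (W ω, V ω)) ⁻¹' (fut ∩ Prod.snd ⁻¹' past)) := measure_mono hsub
    _ = ((P.map W).prod (P.map V)) (fut ∩ Prod.snd ⁻¹' past) := by
        rw [← hmap, Measure.map_apply (hWm.prodMk hVm) hset]
    _ = ∫⁻ p, P.map W ((fun w => (w, p)) ⁻¹' (fut ∩ Prod.snd ⁻¹' past)) ∂P.map V :=
        Measure.prod_apply_symm hset
    _ ≤ ∫⁻ p, past.indicator (fun _ => ENNReal.ofReal (1 - δ)) p ∂P.map V := by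
        refine lintegral_mono fun p => ?_
        by_cases hp : p ∈ past
        · rw [Set.indicator_of_mem hp]
          exact (measure_mono fun w hw => hw.1).trans (hfib p)
        · rw [Set.indicator_of_notMem hp]
          refine (measure_mono_null (fun w hw => hp hw.2) measure_empty).le
    _ = ENNReal.ofReal (1 - δ) * P (rationalAvoidEvent B c r T) := by
        rw [lintegral_indicator_const hpastm, Measure.map_apply hVm hpastm, hpre]

/-- Continuity from above along `T → ∞` turns the loss of mass into `p ≤ (1 - δ) p` for the
probability `p` of the intersection. -/
theorem prob_rationalAvoidEvent_eq_zero [IsProbabilityMeasure P]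
    {B : ℝ≥0 → Ω → EuclideanSpace ℝ (Fin d)} (hB : IsPreBrownianMotion B P)
    (c : ℕ → EuclideanSpace ℝ (Fin d)) (r : ℕ → ℝ) {δ : ℝ} (hδ0 : 0 < δ)
    (hδ : ∀ B' : ℝ≥0 → Ω → EuclideanSpace ℝ (Fin d), IsPreBrownianMotion B' P → ∀ y,
      δ ≤ P.real {ω | ∃ k m n : ℕ, y + B' (k / (m + 1)) ω ∈ Metric.ball (c n) (r n)}) :
    P (⋂ S : ℕ, rationalAvoidEvent B c r S) = 0 := by
  have hle := fun T : ℕ => prob_avoid_le_mul hB c r T (hδ (fun t ω => B (T + t) ω - B T ω) (hB.shift T))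
  have hanti : Antitone fun T : ℕ => rationalAvoidEvent B c r T := by
    intro S T hST ω hω k m n hk
    exact hω k m n (hk.trans (by exact_mod_cast hST))
  have hlim := tendsto_measure_iInter_atTop (μ := P)
    (fun T : ℕ => (measurableSet_rationalAvoidEvent hB.measurable c r T).nullMeasurableSet)
    hanti ⟨0, measure_ne_top _ _⟩
  have hlim' := ge_of_tendsto' (ENNReal.Tendsto.const_mul (a := ENNReal.ofReal (1 - δ)) hlim
    (Or.inr ENNReal.ofReal_ne_top)) hle
  by_contra hne
  have hlt : ENNReal.ofReal (1 - δ) < 1 := by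
    rw [← ENNReal.ofReal_one]; exact (ENNReal.ofReal_lt_ofReal_iff one_pos).2 (by linarith)
  have := (ENNReal.mul_lt_mul_iff_left hne (measure_ne_top _ _)).2 hlt
  rw [one_mul] at this
  exact (hlim'.trans_lt this).false

end Avoidance

end AvoidableBalls

theorem theorem2 {d : ℕ} (hd : 3 ≤ d)
    {Ω : Type*} [MeasurableSpace Ω] (P : Measure Ω) [IsProbabilityMeasure P]
    (B : ℝ≥0 → Ω → EuclideanSpace ℝ (Fin d)) (hB : AvoidableBalls.IsBrownianMotion B P)
    (c : ℕ → EuclideanSpace ℝ (Fin d)) (r : ℕ → ℝ) (hr : ∀ n, 0 < r n)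
    (hdisj : AvoidableBalls.NonOverlapping c r)
    (h0 : ∀ n, (0 : EuclideanSpace ℝ (Fin d)) ∉ Metric.closedBall (c n) (r n))
    (hsep : AvoidableBalls.Separated c)
    (M : ℝ) (hM : ∀ n, r n ^ (d - 2) * ‖c n‖ ^ 2 ≤ M)
    (havoid : AvoidableBalls.Avoidable B P c r) :
    Summable (fun n => (r n / ‖c n‖) ^ (d - 2)) := by
  by_contra hns
  obtain ⟨B', hB', hmod⟩ := hB.exists_modification
  obtain ⟨δ, hδ0, hδ⟩ :=
    AvoidableBalls.exists_uniform_hit_prob_of_not_summable (P := P) hd hr hsep hM hns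
  have hzero := AvoidableBalls.prob_rationalAvoidEvent_eq_zero hB' c r hδ0 hδ
  refine havoid.ne' (le_antisymm ((measure_mono_ae ?_).trans hzero.le) zero_le)
  -- Only countably many times matter, so a modification agrees with `B` at all of them almost
  -- surely.
  have hae : ∀ᵐ ω ∂P, ∀ k m : ℕ, B (k / (m + 1)) ω = B' (k / (m + 1)) ω :=
    ae_all_iff.2 fun k => ae_all_iff.2 fun m => hmod _
  filter_upwards [hae] with ω hω hav
  refine Set.mem_iInter.2 fun S k m n _ hmem => ?_
  rw [← hω k m] at hmem
  exact hav _ n (Metric.ball_subset_closedBall hmem)
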